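/- Setting. Let $N,m\ge 1$, let $\mathcal H=\mathcal H_1\oplus\cdots\oplus\mathcal H_m$ be the Hilbert direct sum of separable real Hilbert spaces, and let $F_1,\dots,F_N:\mathcal H\to\mathcal H$ be nonexpansive with $X^*:=\bigcap_{i}\{x: F_i(x)=x\}\ne\emptyset$. Assume that $\{F_i\}$ is boundedly power regular: for every bounded $\Theta\subset\mathcal H$ there is $\kappa\ge 0$ with $d_{X^*}(x)\le\kappa\sum_{i=1}^N\|x-F_i(x)\|$ for all $x\in\Theta$, where $d_{X^*}(x)=\inf_{z\in X^*}\|x-z\|$. Let $P_{X^*}$ be the metric projection onto $X^*$. Network. Let $A_k=(a_{ij,k})$, $k\in\mathbb N$, be nonnegative row-stochastic $N\times N$ matrices with positive diagonals such that, for some $\underline a\in(0,1)$, $a_{ij,k}>\underline a$ whenever $a_{ij,k}>0$, and such that, for some integer $Q>0$ and all $k\ge 0$, the union of the digraphs $\{(j,i):a_{ij,k+l}>0\}$, $l=1,\dots,Q$, is strongly connected. Put $A^{s:k}=A_{s-1}\cdots A_k$ for $s\ge k$, with $A^{k:k}=I$. Iteration (D-IBKM). On a probability space, let $x_{i,0}$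 be $\mathcal H$-valued random vectors with $\mathbb E\|x_{i,0}\|^2<\infty$, and for $i\in[N]$, $k\in\mathbb N$, $l\in[m]$ let, almost surely, $$x_{il,k+1}=\hat x_{il,k}+b_{il,k}\alpha_{i,k}\big(F_{il}(\hat x_{i,k})+\epsilon_{il,k}-\hat x_{il,k}\big),\qquad \hat x_{i,k}=\sum_{j=1}^N a_{ij,k}x_{j,k},$$ where $\alpha_{i,k}\in[\alpha,1-\alpha]$ are deterministic, $\alpha\in(0,1/2]$; the random vectors $b_{i,k}\in\{0,1\}^m\setminus\{0\}$ are, for each $i$, identically distributed in $k$, with $p_l:=\mathbb P(b_{il,0}=1)>0$ not depending on $i$; $b_{i,k}$ is independent of $\chi_k:=\sigma(x_{j,t}: j\in[N],\,t\le k)$ and of $b_{j,k}$ for $j\ne i$; and the random errors $\epsilon_{i,k}$ are square integrable and satisfy, for all $i$, $$\sum_{k}\sqrt{\mathbb E(\|\epsilon_{i,k}\|^2\mid\chi_k)}<\infty\ \text{ a.s.}$$ Assume also that the conditional second moments of the effective errors $\varepsilon_{i,k}:=(b_{il,k}\epsilon_{il,k})_{l\in[m]}$ are dominated: $\mathbb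 E(\|\varepsilon_{i,k}\|^2\mid\chi_k)\le g$ a.s. for all $i,k$, for some integrable random variable $g$ (for instance a constant). Let $|||y|||^2=\sum_{l=1}^m\|y_l\|^2/p_l$, $p_0=\min_l p_l$, $\alpha_c=\sup_{i,k}\alpha_{i,k}$. Claim. There exist $\pi_k=(\pi_{1,k},\dots,\pi_{N,k})$, $k\in\mathbb N$, and constants $\varpi>0$, $\xi\in(0,1)$, $\underline\pi>0$ such that for all $k$, all $s\ge k$ and all $i,j$ $$\sum_i\pi_{i,k}=1,\quad |(A^{s:k})_{ij}-\pi_{j,k}|\le\varpi\xi^{s-k},\quad \pi_{i,k}\ge\underline\pi,\quad \pi_k^\top=\pi_{k+1}^\top A_k. \qquad(\ast)$$ For every such choice of $\pi_k,\varpi,\xi,\underline\pi$, and for every constant $\nu>0$ such that almost surely $$d_{X^*}(y)\le\nu\sum_{i=1}^N\|F_i(y)-y\|\quad\text{whenever } \|y\|\le\|x_{i,k}\|\text{ for some } i,k$$ (for instance, if $\|x_{i,k}\|\le\Upsilon$ a.s. for all $i,k$, and the inequality holds on the ball $B(0;\Upsilon)$), the following holds. If $$\alpha_c<\min\Big\{\frac{p_0(1-\xi)}{4N^2\varpi\xi}\sqrt{\frac{\underline\pi}{2(p_0^2+8N\nu^2)}},\;1-\alpha\Big\},$$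 then, with $q_k:=\sum_{i=1}^N\pi_{i,k}P_{X^*}(x_{i,k})$, for every $i\in[N]$ the variables $|||x_{i,k}-q_k|||^2$ are integrable and $$\lim_{k\to\infty}\mathbb E\big(|||x_{i,k}-q_k|||^2\big)=0 .$$ If moreover $\epsilon_{i,k}=0$ a.s. for all $i,k$ (D-BKM), then $\mathbb E(|||x_{i,k}-q_k|||^2)=O\big(1/k^{\ln(1/\xi)}\big)$ for every $i\in[N]$. -/

import Mathlib

open MeasureTheory ProbabilityTheory Filter Topology Asymptotics

noncomputable section

/-- The communication graph of a weight matrix: there is an edge from `j` to `i`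
exactly when the weight `B i j` is positive. -/
def commGraph {N : ℕ} (B : Matrix (Fin N) (Fin N) ℝ) : Digraph (Fin N) where
  Adj j i := 0 < B i j

/-- A digraph is strongly connected if every node can be reached from every node
along a directed path. -/
def StronglyConnected {V : Type*} (G : Digraph V) : Prop :=
  ∀ u v : V, Relation.ReflTransGen G.Adj u v

/-- The graph connectivity and weights rule for the weight matrices `A k = (a_{ij,k})`:
nonnegative row-stochastic matrices with positive diagonal, whose positive entries exceed a common
`a ∈ (0,1)`, and whose graphs are uniformly jointly strongly connected. -/
structure ConnectivityAndWeights {N : ℕ} (A : ℕ → Matrix (Fin N) (Fin N) ℝ) : Prop where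
  nonneg : ∀ k i j, 0 ≤ A k i j
  diag_pos : ∀ k i, 0 < A k i i
  row_sum : ∀ k i, ∑ j, A k i j = 1
  lower_bound : ∃ a : ℝ, 0 < a ∧ a < 1 ∧ ∀ k i j, 0 < A k i j → a < A k i j
  jointly_connected : ∃ Q : ℕ, 0 < Q ∧
    ∀ k : ℕ, StronglyConnected (⨆ l ∈ Finset.Icc 1 Q, commGraph (A (k + l)))

/-- `transMat A k n` is the backward product `A_{k+n-1} ⋯ A_{k+1} A_k`
(the identity matrix for `n = 0`). -/
def transMat {N : ℕ} (A : ℕ → Matrix (Fin N) (Fin N) ℝ) (k : ℕ) :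
    ℕ → Matrix (Fin N) (Fin N) ℝ
  | 0 => 1
  | n + 1 => A (k + n) * transMat A k n

/-- `w k = (π_{1,k}, …, π_{N,k})` are the limiting weights of the backward products of the
matrices `A k`, with the geometric bound `ϖ ξ ^ (s - k)`, and `wmin` is a positive lower bound for
all of these weights. -/
structure IsMixing {N : ℕ} (A : ℕ → Matrix (Fin N) (Fin N) ℝ)
    (w : ℕ → Fin N → ℝ) (ϖ ξ wmin : ℝ) : Prop where
  ϖ_pos : 0 < ϖ
  ξ_pos : 0 < ξ
  ξ_lt_one : ξ < 1
  wmin_pos : 0 < wmin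
  sum_eq_one : ∀ k, ∑ i, w k i = 1
  geometric : ∀ k n i j, |transMat A k n i j - w k j| ≤ ϖ * ξ ^ n
  lower : ∀ k i, wmin ≤ w k i
  invariant : ∀ k, w k = Matrix.vecMul (w (k + 1)) (A k)

/-- The set of common fixed points of a family of operators. -/
def commonFix {ι E : Type*} (T : ι → E → E) : Set E :=
  {x | ∀ i, T i x = x}

/-- Bounded power regularity of a finite family of operators on the whole space. -/
def BoundedlyPowerRegular {ι E : Type*} [Fintype ι] [NormedAddCommGroup E]
    (T : ι → E → E) : Prop :=
  (commonFix T).Nonempty ∧ ∀ Θ : Set E, Bornology.IsBounded Θ →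
    ∃ κ : ℝ, 0 ≤ κ ∧ ∀ x ∈ Θ, Metric.infDist x (commonFix T) ≤ κ * ∑ i, ‖x - T i x‖

/-- The projection of `z` onto `S`: a point of `S` nearest to `z`. -/
def metricProj {E : Type*} [NormedAddCommGroup E] (S : Set E) (z : E) : E :=
  Classical.epsilon fun x => x ∈ S ∧ ‖z - x‖ = Metric.infDist z S

/-- On a nonempty closed convex subset of a Hilbert space, `metricProj` is the unique nearest
point. -/
theorem metricProj_spec {E : Type*} [NormedAddCommGroup E] [InnerProductSpace ℝ E]
    [CompleteSpace E] {S : Set E} (hne : S.Nonempty) (hcl : IsClosed S) (hcv : Convex ℝ S)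
    (z : E) :
    metricProj S z ∈ S ∧ ‖z - metricProj S z‖ = Metric.infDist z S := by
  obtain ⟨v, hv, hz⟩ := exists_norm_eq_iInf_of_complete_convex hne hcl.isComplete hcv z
  refine Classical.epsilon_spec (p := fun x => x ∈ S ∧ ‖z - x‖ = Metric.infDist z S) ⟨v, hv, ?_⟩
  rw [hz, Metric.infDist_eq_iInf]
  simp only [dist_eq_norm]

/-- The squared weighted norm `|||y|||² = ∑ l, ‖y_l‖² / p_l`. -/
def wnormSq {m : ℕ} {H : Fin m → Type*} [∀ l, NormedAddCommGroup (H l)]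
    (p : Fin m → ℝ) (y : PiLp 2 H) : ℝ :=
  ∑ l, 1 / p l * ‖y l‖ ^ 2

/-- The vector with blocks `c_l e_l`, for `c ∈ {0,1}^m`. -/
def mask {m : ℕ} {H : Fin m → Type*} [∀ l, NormedAddCommGroup (H l)]
    (c : Fin m → Bool) (e : PiLp 2 H) : PiLp 2 H :=
  WithLp.toLp 2 fun l => if c l then e l else 0

/-- The aggregate `x̂_{i,k} = ∑ j, a_{ij,k} x_{j,k}`, as a random vector. -/
def aggregate {N : ℕ} {Ω E : Type*} [AddCommGroup E] [Module ℝ E]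
    (A : ℕ → Matrix (Fin N) (Fin N) ℝ) (x : Fin N → ℕ → Ω → E)
    (i : Fin N) (k : ℕ) (ω : Ω) : E :=
  ∑ j, A k i j • x j k ω

/-- The σ-algebra `χ_k` generated by all `x_{j,t}` with `t ≤ k`. -/
@[reducible] def history {N : ℕ} {Ω E : Type*} [MeasurableSpace E] (x : Fin N → ℕ → Ω → E) (k : ℕ) :
    MeasurableSpace Ω :=
  ⨆ (j : Fin N) (t : ℕ) (_ : t ≤ k), MeasurableSpace.comap (x j t) inferInstance

/-- `x` is generated by the distributed inexact block-coordinate Krasnosel'skiĭ–Mann iteration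
with operators `F`, weights `A`, relaxation parameters `α`, random activations `b` and errors `ε`,
where block `l` is activated with probability `p l`. -/
structure IsDIBKM {N m : ℕ} {H : Fin m → Type*} [∀ l, NormedAddCommGroup (H l)]
    [∀ l, InnerProductSpace ℝ (H l)] [∀ l, MeasurableSpace (H l)]
    {Ω : Type*} [MeasurableSpace Ω] (P : Measure Ω)
    (F : Fin N → PiLp 2 H → PiLp 2 H) (A : ℕ → Matrix (Fin N) (Fin N) ℝ)
    (α : Fin N → ℕ → ℝ) (p : Fin m → ℝ) (b : Fin N → ℕ → Ω → Fin m → Bool)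
    (ε x : Fin N → ℕ → Ω → PiLp 2 H) : Prop where
  measurable_x : ∀ i k, Measurable (x i k)
  measurable_ε : ∀ i k, Measurable (ε i k)
  measurable_b : ∀ i k, Measurable (b i k)
  /-- at least one block is activated -/
  active : ∀ i k, ∀ᵐ ω ∂P, ∃ l, b i k ω l = true
  identDistrib : ∀ i k, IdentDistrib (b i k) (b i 0) P P
  prob : ∀ i l, P.real {ω | b i 0 ω l = true} = p l
  prob_pos : ∀ l, 0 < p l
  indep_history : ∀ i k,
    Indep (MeasurableSpace.comap (b i k) inferInstance) (history x k) P
  indep_agents : ∀ i j k, i ≠ j → IndepFun (b i k) (b j k) P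
  step : ∀ i k, ∀ᵐ ω ∂P, ∀ l : Fin m,
    x i (k + 1) ω l = aggregate A x i k ω l +
      (if b i k ω l then α i k else 0) •
        (F i (aggregate A x i k ω) l + ε i k ω l - aggregate A x i k ω l)

/-- `q_k = ∑ i, π_{i,k} P_{X*}(x_{i,k})`, as a random vector. -/
def weightedProj {N : ℕ} {Ω E : Type*} [NormedAddCommGroup E] [Module ℝ E]
    (F : Fin N → E → E) (w : ℕ → Fin N → ℝ) (x : Fin N → ℕ → Ω → E) (k : ℕ) (ω : Ω) : E :=
  ∑ i, w k i • metricProj (commonFix F) (x i k ω)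

/-- The step-size condition, with `α_c = max_{i,k} α_{i,k}` and `p₀ = min_l p_l`. -/
def StepSizeBound {N m : ℕ} (α : Fin N → ℕ → ℝ) (αlow : ℝ) (p : Fin m → ℝ)
    (ϖ ξ wmin ν : ℝ) : Prop :=
  (⨆ s : Fin N × ℕ, α s.1 s.2) <
    min ((⨅ l, p l) * (1 - ξ) / (4 * (N : ℝ) ^ 2 * ϖ * ξ) *
        √(wmin / (2 * ((⨅ l, p l) ^ 2 + 8 * (N : ℝ) * ν ^ 2))))
      (1 - αlow)

end

/-! ### Products of stochastic matrices: positivity, contraction and limiting weights. -/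

section Mixing

variable {N : ℕ} {A : ℕ → Matrix (Fin N) (Fin N) ℝ}

/-! Two quantities are followed in mean square: the distance of the states to `commonFix F`, and the
disagreement between the agents. Each recursion involves the other quantity or its driving terms,
and a suitable linear combination of the two contracts.

For the distance, the norm weighted by `1 / p l` is the natural one. An indicator of probability `p
l` divided by `p l` has mean one, and the activations are independent of the past. On average, a
masked increment therefore changes the weighted squared norm exactly as a full Krasnosel'skiĭ–Mann
step changes the plain one (`integral_wnormSq_add_mask`). The usual descent by a multiple of the
squared residual follows. Averaging over neighbours costs nothing, by convexity of the squared
distance and invariance of the weights, so their weighted mean obeys `D' ≤ (1+η)(D - cR) + error`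
(`meanDistSq_succ_le`), with `R` the sum of the expected squared residuals.

For the disagreement, geometric mixing of the matrix products gives a pathwise bound with `φ' = ξφ +
ϖ · (increments)` (`norm_transMat_sub_le`). The increments are controlled by the residuals and the
errors, so the mean square `Φ` of `φ` obeys `Φ' ≤ ξΦ + C₁(R + error)`.

Power regularity closes the loop: `D ≤ C₂(R + Φ)` (`wdistSq_state_le`). In `D + βΦ` the descent
`-cR` pays for the residuals that feed `Φ` and still forces a proportional decrease of `D`
(`exists_lyapunov_weights`). The combination contracts by a factor `ρ < 1` up to the second moments
of the effective errors, which vanish by dominated convergence. It dominates the quantity to be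
estimated (`wnormSq_sub_weightedProj_le`). Without errors the decay is geometric, hence faster than
every power of `1/k`. -/

theorem transMat_add (A : ℕ → Matrix (Fin N) (Fin N) ℝ) (k n r : ℕ) :
    transMat A k (n + r) = transMat A (k + n) r * transMat A k n := by
  induction r with
  | zero => simp [transMat]
  | succ r ih =>
    rw [← add_assoc, transMat, ih, transMat, Matrix.mul_assoc, add_assoc]

theorem transMat_one (A : ℕ → Matrix (Fin N) (Fin N) ℝ) (k : ℕ) : transMat A k 1 = A k := by
  simp [transMat]

theorem transMat_succ_right (A : ℕ → Matrix (Fin N) (Fin N) ℝ) (k n : ℕ) :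
    transMat A k (n + 1) = transMat A (k + 1) n * A k := by
  rw [add_comm, transMat_add, transMat_one]

namespace ConnectivityAndWeights

theorem transMat_nonneg (hA : ConnectivityAndWeights A) (k n : ℕ) (i j : Fin N) :
    0 ≤ transMat A k n i j := by
  induction n generalizing i j with
  | zero =>
    rw [transMat, Matrix.one_apply]
    split_ifs <;> norm_num
  | succ n ih =>
    rw [transMat, Matrix.mul_apply]
    exact Finset.sum_nonneg fun l _ => mul_nonneg (hA.nonneg _ _ _) (ih l j)

theorem transMat_row_sum (hA : ConnectivityAndWeights A) (k n : ℕ) (i : Fin N) :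
    ∑ j, transMat A k n i j = 1 := by
  induction n generalizing i with
  | zero => simp [transMat, Matrix.one_apply]
  | succ n ih =>
    simp only [transMat, Matrix.mul_apply]
    rw [Finset.sum_comm]
    simp only [← Finset.mul_sum, ih, mul_one, hA.row_sum]

/-- Positive entries of a backward product of `n` factors are at least `a ^ n`. -/
theorem pow_le_transMat (hA : ConnectivityAndWeights A) {a : ℝ} (ha : 0 < a)
    (hlow : ∀ k i j, 0 < A k i j → a < A k i j) (k n : ℕ) (i j : Fin N)
    (h : 0 < transMat A k n i j) : a ^ n ≤ transMat A k n i j := by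
  induction n generalizing i j with
  | zero =>
    rw [transMat, Matrix.one_apply] at h ⊢
    split_ifs at h ⊢ <;> simp_all
  | succ n ih =>
    rw [transMat, Matrix.mul_apply] at h ⊢
    obtain ⟨l, -, hl⟩ := Finset.exists_lt_of_sum_lt (f := fun _ : Fin N => (0 : ℝ))
      (s := Finset.univ) (by simpa using h)
    have h1 : 0 < A (k + n) i l :=
      pos_of_mul_pos_left hl (hA.transMat_nonneg k n l j)
    have h2 : 0 < transMat A k n l j := pos_of_mul_pos_right hl (hA.nonneg _ _ _)
    calc a ^ (n + 1) = a * a ^ n := by ring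
      _ ≤ A (k + n) i l * transMat A k n l j :=
        mul_le_mul (hlow _ _ _ h1).le (ih l j h2) (by positivity) h1.le
      _ ≤ _ := Finset.single_le_sum (f := fun l => A (k + n) i l * transMat A k n l j)
        (fun l _ => mul_nonneg (hA.nonneg _ _ _) (hA.transMat_nonneg k n l j))
        (Finset.mem_univ l)

theorem transMat_succ_pos (hA : ConnectivityAndWeights A) {k n : ℕ} {i l j : Fin N}
    (h1 : 0 < A (k + n) i l) (h2 : 0 < transMat A k n l j) : 0 < transMat A k (n + 1) i j := by
  rw [transMat, Matrix.mul_apply]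
  exact (mul_pos h1 h2).trans_le
    (Finset.single_le_sum (f := fun l => A (k + n) i l * transMat A k n l j)
      (fun l _ => mul_nonneg (hA.nonneg _ _ _) (hA.transMat_nonneg k n l j)) (Finset.mem_univ l))

theorem transMat_pos_mono (hA : ConnectivityAndWeights A) {k n r : ℕ} (hnr : n ≤ r) {i j : Fin N}
    (h : 0 < transMat A k n i j) : 0 < transMat A k r i j := by
  induction r, hnr using Nat.le_induction with
  | base => exact h
  | succ r _ ih => exact hA.transMat_succ_pos (hA.diag_pos _ _) ih

end ConnectivityAndWeights

theorem Relation.ReflTransGen.exists_crossing {V : Type*} {r : V → V → Prop} {u v : V}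
    (h : Relation.ReflTransGen r u v) {S : Set V} (hu : u ∈ S) (hv : v ∉ S) :
    ∃ a b, r a b ∧ a ∈ S ∧ b ∉ S := by
  induction h with
  | refl => exact absurd hu hv
  | @tail b c _ hbc ih =>
    by_cases hb : b ∈ S
    · exact ⟨b, c, hbc, hb, hv⟩
    · exact ih hb

namespace ConnectivityAndWeights

/-- The set of nodes that information from `j` at time `k` reaches within `n` steps. -/
noncomputable def reach (A : ℕ → Matrix (Fin N) (Fin N) ℝ) (k : ℕ) (j : Fin N) (n : ℕ) :
    Finset (Fin N) :=
  open Classical in Finset.univ.filter fun i => 0 < transMat A k n i j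

theorem mem_reach {k n : ℕ} {i j : Fin N} : i ∈ reach A k j n ↔ 0 < transMat A k n i j := by
  simp [reach]

theorem reach_mono (hA : ConnectivityAndWeights A) (k : ℕ) (j : Fin N) :
    Monotone (reach A k j) := fun _ _ hnr _ hi =>
  mem_reach.2 (hA.transMat_pos_mono hnr (mem_reach.1 hi))

/-- A path from `j` to an unreached node must leave the reached set along some edge. That edge is
present at a time `k + n + l` with `1 ≤ l ≤ Q`, and the matrix of that time enters only the product
of `n + l + 1` factors; hence the window `Q + 1`. Positive diagonals keep reached nodes reached. -/
theorem reach_ssubset (hA : ConnectivityAndWeights A) {Q : ℕ}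
    (hQ : ∀ k : ℕ, StronglyConnected (⨆ l ∈ Finset.Icc 1 Q, commGraph (A (k + l))))
    (k : ℕ) (j : Fin N) (n : ℕ) (hne : reach A k j n ≠ Finset.univ) :
    reach A k j n ⊂ reach A k j (n + (Q + 1)) := by
  refine Finset.ssubset_iff_subset_ne.2 ⟨hA.reach_mono k j (by omega), fun heq => ?_⟩
  obtain ⟨v, hv⟩ : ∃ v, v ∉ reach A k j n := by
    by_contra! h
    exact hne (Finset.eq_univ_iff_forall.2 h)
  have hj : j ∈ reach A k j n := hA.reach_mono k j (Nat.zero_le n)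
    (mem_reach.2 (by simp [transMat]))
  obtain ⟨u, v', hadj, hu, hv'⟩ := (hQ (k + n) j v).exists_crossing
    (S := (reach A k j n : Set (Fin N))) hj hv
  simp only [Digraph.iSup_adj] at hadj
  obtain ⟨l, hl, hadj⟩ := hadj
  rw [Finset.mem_Icc] at hl
  have hu' : 0 < transMat A k (n + l) u j :=
    hA.transMat_pos_mono (by omega) (mem_reach.1 hu)
  have h1 : 0 < transMat A k (n + l + 1) v' j :=
    hA.transMat_succ_pos (by rw [← add_assoc]; exact hadj) hu'
  apply hv'
  rw [heq]
  exact mem_reach.2 (hA.transMat_pos_mono (by omega) h1)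

theorem reach_eq_univ (hA : ConnectivityAndWeights A) {Q : ℕ}
    (hQ : ∀ k : ℕ, StronglyConnected (⨆ l ∈ Finset.Icc 1 Q, commGraph (A (k + l))))
    (k : ℕ) (j : Fin N) : reach A k j (N * (Q + 1)) = Finset.univ := by
  have key : ∀ n, reach A k j (n * (Q + 1)) = Finset.univ ∨
      n ≤ (reach A k j (n * (Q + 1))).card := by
    intro n
    induction n with
    | zero => exact Or.inr (Nat.zero_le _)
    | succ n ih =>
      by_cases hne : reach A k j (n * (Q + 1)) = Finset.univ
      · left
        refine Finset.eq_univ_iff_forall.2 fun i => ?_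
        exact hA.reach_mono k j (Nat.mul_le_mul_right _ n.le_succ) (hne ▸ Finset.mem_univ i)
      · right
        have h := Finset.card_lt_card (hA.reach_ssubset hQ k j _ hne)
        rw [Nat.succ_mul]
        have := ih.resolve_left hne
        omega
  rcases key N with h | h
  · exact h
  · refine (Finset.card_eq_iff_eq_univ _).1 (le_antisymm (Finset.card_le_univ _) ?_)
    simpa using h

/-- All long backward products are uniformly positive. -/
theorem exists_uniform_lower (hA : ConnectivityAndWeights A) :
    ∃ (M : ℕ) (η : ℝ), 0 < M ∧ 0 < η ∧ η < 1 ∧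
      ∀ k n, M ≤ n → ∀ i j, η ≤ transMat A k n i j := by
  obtain ⟨a, ha, ha1, hlow⟩ := hA.lower_bound
  obtain ⟨Q, -, hQ⟩ := hA.jointly_connected
  have hbase : ∀ k i j, a ^ (N * (Q + 1)) ≤ transMat A k (N * (Q + 1)) i j := fun k i j =>
    hA.pow_le_transMat ha hlow _ _ _ _ (mem_reach.1 (hA.reach_eq_univ hQ k j ▸ Finset.mem_univ i))
  have h1 : a ^ (N * (Q + 1) + 1) ≤ a ^ (N * (Q + 1)) :=
    pow_le_pow_of_le_one ha.le ha1.le (Nat.le_succ _)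
  -- The extra `+ 1` makes `M` positive and the power of `a` strictly less than one, also for `N =
  -- 0`.
  refine ⟨N * (Q + 1) + 1, a ^ (N * (Q + 1) + 1), by omega, by positivity,
    pow_lt_one₀ ha.le ha1 (by omega), fun k n hn i j => ?_⟩
  -- The later factors form a row-stochastic matrix on the left, and averages of entries above a
  -- bound stay above it.
  obtain ⟨r, rfl⟩ := Nat.exists_eq_add_of_le (Nat.le_of_succ_le hn)
  rw [transMat_add, Matrix.mul_apply]
  calc a ^ (N * (Q + 1) + 1) ≤ a ^ (N * (Q + 1)) := h1
    _ = ∑ l, transMat A (k + N * (Q + 1)) r i l * a ^ (N * (Q + 1)) := by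
      rw [← Finset.sum_mul, hA.transMat_row_sum, one_mul]
    _ ≤ _ := Finset.sum_le_sum fun l _ =>
      mul_le_mul_of_nonneg_left (hbase k l j) (hA.transMat_nonneg _ _ _ _)

/-- The columns of the backward products contract to constants. -/
theorem exists_column_bounds (hA : ConnectivityAndWeights A) (hN : 0 < N) {M : ℕ} {η : ℝ}
    (hη1 : η < 1) (hη : ∀ k n, M ≤ n → ∀ i j, η ≤ transMat A k n i j) (k : ℕ) (j : Fin N)
    (q : ℕ) : ∃ lo hi : ℝ, hi - lo ≤ (1 - η) ^ q ∧
      ∀ n, q * M ≤ n → ∀ i, lo ≤ transMat A k n i j ∧ transMat A k n i j ≤ hi := by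
  have : Nonempty (Fin N) := ⟨⟨0, hN⟩⟩
  induction q with
  | zero =>
    refine ⟨0, 1, by simp, fun n _ i => ⟨hA.transMat_nonneg k n i j, ?_⟩⟩
    rw [← hA.transMat_row_sum k n i]
    exact Finset.single_le_sum (fun l _ => hA.transMat_nonneg k n i l) (Finset.mem_univ j)
  | succ q ih =>
    obtain ⟨lo, hi, hd, hb⟩ := ih
    obtain ⟨i₁, -, h₁⟩ := Finset.exists_min_image Finset.univ
      (fun i => transMat A k (q * M) i j) Finset.univ_nonempty
    obtain ⟨i₂, -, h₂⟩ := Finset.exists_max_image Finset.univ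
      (fun i => transMat A k (q * M) i j) Finset.univ_nonempty
    set v := fun i => transMat A k (q * M) i j with hv
    have h12 : v i₂ - v i₁ ≤ hi - lo := by
      have := (hb (q * M) le_rfl i₁).1
      have := (hb (q * M) le_rfl i₂).2
      simp only [hv]; linarith
    refine ⟨v i₁, v i₂ - η * (v i₂ - v i₁), ?_, fun n hn i => ?_⟩
    · calc v i₂ - η * (v i₂ - v i₁) - v i₁ = (v i₂ - v i₁) * (1 - η) := by ring
        _ ≤ (1 - η) ^ q * (1 - η) :=
          mul_le_mul_of_nonneg_right (h12.trans hd) (by linarith)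
        _ = (1 - η) ^ (q + 1) := (pow_succ _ _).symm
    obtain ⟨r, rfl⟩ := Nat.exists_eq_add_of_le (show q * M ≤ n by nlinarith)
    have hr : M ≤ r := by nlinarith
    rw [transMat_add, Matrix.mul_apply]
    set B := transMat A (k + q * M) r with hB
    have hsum : ∑ l, B i l = 1 := hA.transMat_row_sum _ _ _
    constructor
    · calc v i₁ = ∑ l, B i l * v i₁ := by rw [← Finset.sum_mul, hsum, one_mul]
        _ ≤ _ := Finset.sum_le_sum fun l _ => mul_le_mul_of_nonneg_left
          (h₁ l (Finset.mem_univ l)) (hA.transMat_nonneg _ _ _ _)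
    · have e : v i₂ - ∑ l, B i l * v l = ∑ l, B i l * (v i₂ - v l) := by
        simp only [mul_sub, Finset.sum_sub_distrib, ← Finset.sum_mul, hsum, one_mul]
      -- Every row of `B` puts weight at least `η` on the row attaining the minimum, which pulls
      -- each average below the maximum by `η` times the spread.
      have hsingle : B i i₁ * (v i₂ - v i₁) ≤ ∑ l, B i l * (v i₂ - v l) :=
        Finset.single_le_sum (f := fun l => B i l * (v i₂ - v l))
          (fun l _ => mul_nonneg (hA.transMat_nonneg _ _ _ _)
            (sub_nonneg.2 (h₂ l (Finset.mem_univ l)))) (Finset.mem_univ i₁)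
      have h3 : η * (v i₂ - v i₁) ≤ B i i₁ * (v i₂ - v i₁) :=
        mul_le_mul_of_nonneg_right (hη _ _ hr _ _)
          (sub_nonneg.2 (h₂ i₁ (Finset.mem_univ _)))
      change ∑ l, B i l * v l ≤ _
      linarith

theorem exists_isMixing (hA : ConnectivityAndWeights A) (hN : 0 < N) :
    ∃ (w : ℕ → Fin N → ℝ) (ϖ ξ wmin : ℝ), IsMixing A w ϖ ξ wmin := by
  obtain ⟨M, η, hM, hη0, hη1, hη⟩ := hA.exists_uniform_lower
  have hcb := hA.exists_column_bounds hN hη1 hη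
  have h1η : 0 < 1 - η := by linarith
  let i₀ : Fin N := ⟨0, hN⟩
  -- Rows and lengths both vary here, so the limit of a column exists and does not depend on the
  -- row.
  have hclose : ∀ k j q n n', q * M ≤ n → q * M ≤ n' → ∀ i i',
      |transMat A k n i j - transMat A k n' i' j| ≤ (1 - η) ^ q := by
    intro k j q n n' hn hn' i i'
    obtain ⟨lo, hi, hd, hb⟩ := hcb k j q
    have a1 := hb n hn i
    have a2 := hb n' hn' i'
    rw [abs_le]
    constructor <;> linarith
  have hpow : Tendsto (fun q : ℕ => (1 - η) ^ q) atTop (𝓝 0) :=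
    tendsto_pow_atTop_nhds_zero_of_lt_one h1η.le (by linarith)
  have hlim : ∀ k j, ∃ c, Tendsto (fun n => transMat A k n i₀ j) atTop (𝓝 c) := by
    intro k j
    refine cauchySeq_tendsto_of_complete (Metric.cauchySeq_iff.2 fun δ hδ => ?_)
    obtain ⟨q, hq⟩ := (hpow.eventually (gt_mem_nhds hδ)).exists
    refine ⟨q * M, fun n hn n' hn' => ?_⟩
    rw [Real.dist_eq]
    exact (hclose k j q n n' hn hn' _ _).trans_lt hq
  choose w hw₀ using hlim
  have hwclose : ∀ k j q n, q * M ≤ n → ∀ i, |transMat A k n i j - w k j| ≤ (1 - η) ^ q := by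
    intro k j q n hn i
    have ht : Tendsto (fun n' => |transMat A k n i j - transMat A k n' i₀ j|) atTop
        (𝓝 |transMat A k n i j - w k j|) := (tendsto_const_nhds.sub (hw₀ k j)).abs
    refine le_of_tendsto ht ?_
    filter_upwards [eventually_ge_atTop (q * M)] with n' hn'
    exact hclose k j q n n' hn hn' _ _
  have hw : ∀ k j i, Tendsto (fun n => transMat A k n i j) atTop (𝓝 (w k j)) := by
    intro k j i
    rw [Metric.tendsto_atTop]
    intro δ hδ
    obtain ⟨q, hq⟩ := (hpow.eventually (gt_mem_nhds hδ)).exists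
    refine ⟨q * M, fun n hn => ?_⟩
    rw [Real.dist_eq]
    exact (hwclose k j q n hn i).trans_lt hq
  set ξ : ℝ := (1 - η) ^ (1 / (M : ℝ)) with hξ
  have hM' : (0 : ℝ) < M := by exact_mod_cast hM
  have hξ0 : 0 < ξ := Real.rpow_pos_of_pos h1η _
  have hξ1 : ξ < 1 := Real.rpow_lt_one h1η.le (by linarith) (by positivity)
  have hξM : ξ ^ M = 1 - η := by
    rw [hξ, ← Real.rpow_natCast, ← Real.rpow_mul h1η.le, one_div, inv_mul_cancel₀ hM'.ne',
      Real.rpow_one]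
  -- The contraction by `1 - η = ξ ^ M` is known only per full block of `M` factors; the factor `1 /
  -- (1 - η)` absorbs the incomplete block lost in `n / M`.
  refine ⟨w, 1 / (1 - η), ξ, η, ⟨by positivity, hξ0, hξ1, hη0, fun k => ?_, fun k n i j => ?_,
    fun k j => ?_, fun k => ?_⟩⟩
  · refine tendsto_nhds_unique (tendsto_finsetSum _ fun j _ => hw k j i₀) ?_
    simp only [hA.transMat_row_sum]
    exact tendsto_const_nhds
  · refine (hwclose k j (n / M) n (Nat.div_mul_le_self n M) i).trans ?_
    rw [one_div, ← div_eq_inv_mul, le_div_iff₀ h1η]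
    calc (1 - η) ^ (n / M) * (1 - η) = ξ ^ (M * (n / M) + M) := by
          rw [pow_add, pow_mul, hξM]
      _ ≤ ξ ^ n := pow_le_pow_of_le_one hξ0.le hξ1.le (by
          have := Nat.div_add_mod n M
          have := Nat.mod_lt n hM
          omega)
  · refine ge_of_tendsto (hw k j i₀) ?_
    filter_upwards [eventually_ge_atTop M] with n hn
    exact hη k n hn i₀ j
  · funext j
    refine tendsto_nhds_unique ((hw k j i₀).comp (tendsto_add_atTop_nat 1)) ?_
    simp only [Function.comp_def, transMat_succ_right, Matrix.mul_apply, Matrix.vecMul,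
      dotProduct]
    exact tendsto_finsetSum _ fun l _ => (hw (k + 1) l i₀).mul_const _

end ConnectivityAndWeights

end Mixing

/-! ### Elementary estimates for nonexpansive maps and norms. -/

section Nonexpansive

theorem isClosed_commonFix {ι E : Type*} [NormedAddCommGroup E] {T : ι → E → E}
    (hT : ∀ i, LipschitzWith 1 (T i)) : IsClosed (commonFix T) := by
  have : commonFix T = ⋂ i, {x | T i x = x} := by
    ext x; simp [commonFix]
  rw [this]
  exact isClosed_iInter fun i => isClosed_eq (hT i).continuous continuous_id

theorem norm_residual_le {E : Type*} [NormedAddCommGroup E]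
    {T : E → E} (hT : LipschitzWith 1 T) (y z : E) :
    ‖T y - y‖ ≤ ‖T z - z‖ + 2 * ‖y - z‖ := by
  have h1 : ‖T y - T z‖ ≤ ‖y - z‖ := by simpa using hT.norm_sub_le y z
  have h2 : ‖T y - y‖ ≤ ‖T y - T z‖ + ‖T z - z‖ + ‖z - y‖ := by
    rw [show T y - y = (T y - T z) + (T z - z) + (z - y) by abel]
    exact norm_add₃_le
  rw [norm_sub_rev z y] at h2
  linarith

theorem norm_add_sq_le_young {E : Type*} [NormedAddCommGroup E] {η : ℝ} (hη : 0 < η) (u v : E) :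
    ‖u + v‖ ^ 2 ≤ (1 + η) * ‖u‖ ^ 2 + (1 + 1 / η) * ‖v‖ ^ 2 := by
  have h1 := pow_le_pow_left₀ (norm_nonneg _) (norm_add_le u v) 2
  have h2 : 0 ≤ (η * ‖u‖ - ‖v‖) ^ 2 / η := by positivity
  have e : (1 + η) * ‖u‖ ^ 2 + (1 + 1 / η) * ‖v‖ ^ 2 - (‖u‖ + ‖v‖) ^ 2 =
      (η * ‖u‖ - ‖v‖) ^ 2 / η := by
    field_simp; ring
  linarith

theorem norm_sum_smul_sq_le {ι E : Type*} [Fintype ι] [NormedAddCommGroup E] [NormedSpace ℝ E]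
    {a : ι → ℝ} (ha : ∀ j, 0 ≤ a j) (ha1 : ∑ j, a j = 1) (y : ι → E) :
    ‖∑ j, a j • y j‖ ^ 2 ≤ ∑ j, a j * ‖y j‖ ^ 2 := by
  have h1 : ‖∑ j, a j • y j‖ ≤ ∑ j, a j * ‖y j‖ :=
    (norm_sum_le _ _).trans_eq (Finset.sum_congr rfl fun j _ => by
      rw [norm_smul, Real.norm_of_nonneg (ha j)])
  refine (pow_le_pow_left₀ (norm_nonneg _) h1 2).trans ?_
  exact (convexOn_pow 2).map_sum_le (fun j _ => ha j) ha1 (fun j _ => norm_nonneg (y j))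

end Nonexpansive

/-! ### Hilbert space geometry: fixed-point sets, projections, relaxed steps. -/

section Projection

variable {E : Type*} [NormedAddCommGroup E] [InnerProductSpace ℝ E]

theorem norm_sq_convexCombo (t : ℝ) (u v : E) :
    ‖(1 - t) • u + t • v‖ ^ 2 =
      (1 - t) * ‖u‖ ^ 2 + t * ‖v‖ ^ 2 - t * (1 - t) * ‖u - v‖ ^ 2 := by
  rw [norm_add_sq_real, norm_sub_sq_real, norm_smul, norm_smul, real_inner_smul_left,
    real_inner_smul_right, mul_pow, mul_pow, Real.norm_eq_abs, Real.norm_eq_abs, sq_abs, sq_abs]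
  ring

/-- The distances from `T z` to `x` and `y` are at most those from `z`, and in `norm_sq_convexCombo`
these bounds leave `‖T z - z‖ ^ 2 ≤ 0`. -/
theorem convex_commonFix {ι : Type*} {T : ι → E → E} (hT : ∀ i, LipschitzWith 1 (T i)) :
    Convex ℝ (commonFix T) := by
  intro x hx y hy s t hs ht hst i
  obtain rfl : s = 1 - t := by linarith
  set z := (1 - t) • x + t • y with hz
  have h1 : ‖T i z - x‖ ≤ ‖z - x‖ := by
    have := (hT i).norm_sub_le z x
    rwa [hx i, NNReal.coe_one, one_mul] at this
  have h2 : ‖T i z - y‖ ≤ ‖z - y‖ := by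
    have := (hT i).norm_sub_le z y
    rwa [hy i, NNReal.coe_one, one_mul] at this
  have ex : z - x = t • (y - x) := by rw [hz]; module
  have ey : z - y = (1 - t) • (x - y) := by rw [hz]; module
  rw [ex, norm_smul, Real.norm_of_nonneg ht, norm_sub_rev y x] at h1
  rw [ey, norm_smul, Real.norm_of_nonneg hs] at h2
  have key := norm_sq_convexCombo t (T i z - x) (T i z - y)
  have e1 : (1 - t) • (T i z - x) + t • (T i z - y) = T i z - z := by rw [hz]; module
  rw [e1, show T i z - x - (T i z - y) = -(x - y) by abel, norm_neg] at key
  have h1' := pow_le_pow_left₀ (norm_nonneg _) h1 2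
  have h2' := pow_le_pow_left₀ (norm_nonneg _) h2 2
  have : ‖T i z - z‖ ^ 2 ≤ 0 := by
    have a1 := mul_le_mul_of_nonneg_left h1' hs
    have a2 := mul_le_mul_of_nonneg_left h2' ht
    rw [key]; nlinarith
  have h0 : ‖T i z - z‖ = 0 := by
    have := sq_nonneg ‖T i z - z‖
    exact pow_eq_zero_iff (two_ne_zero) |>.1 (le_antisymm ‹_› this)
  exact sub_eq_zero.1 (norm_eq_zero.1 h0)

theorem inner_sub_metricProj_le_zero [CompleteSpace E] {S : Set E} (hne : S.Nonempty)
    (hcl : IsClosed S) (hcv : Convex ℝ S) (z : E) {y : E} (hy : y ∈ S) :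
    inner ℝ (z - metricProj S z) (y - metricProj S z) ≤ 0 := by
  obtain ⟨hm, hd⟩ := metricProj_spec hne hcl hcv z
  refine (norm_eq_iInf_iff_real_inner_le_zero hcv hm).1 ?_ y hy
  rw [hd, Metric.infDist_eq_iInf]
  simp only [dist_eq_norm]

/-- Adding the variational inequalities at the two projections gives firm nonexpansiveness, and
Cauchy–Schwarz finishes. -/
theorem lipschitzWith_metricProj [CompleteSpace E] {S : Set E} (hne : S.Nonempty)
    (hcl : IsClosed S) (hcv : Convex ℝ S) : LipschitzWith 1 (metricProj S) := by
  refine LipschitzWith.of_dist_le_mul fun x y => ?_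
  rw [dist_eq_norm, dist_eq_norm, NNReal.coe_one, one_mul]
  set a := metricProj S x
  set c := metricProj S y
  have h1 : inner ℝ (x - a) (c - a) ≤ 0 :=
    inner_sub_metricProj_le_zero hne hcl hcv x (metricProj_spec hne hcl hcv y).1
  have h2 : inner ℝ (y - c) (a - c) ≤ 0 :=
    inner_sub_metricProj_le_zero hne hcl hcv y (metricProj_spec hne hcl hcv x).1
  have h3 : ‖a - c‖ * ‖a - c‖ ≤ inner ℝ (x - y) (a - c) := by
    rw [← real_inner_self_eq_norm_mul_norm]
    have e : inner ℝ (x - y) (a - c) - inner ℝ (a - c) (a - c)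
        = -(inner ℝ (x - a) (c - a) + inner ℝ (y - c) (a - c)) := by
      rw [← neg_sub a c, inner_neg_right, ← inner_sub_left,
        show x - y - (a - c) = (x - a) - (y - c) by abel, inner_sub_left]
      ring
    linarith
  have h4 := h3.trans (real_inner_le_norm _ _)
  rcases (norm_nonneg (a - c)).eq_or_lt with h0 | h0
  · rw [← h0]; exact norm_nonneg _
  · exact le_of_mul_le_mul_right h4 h0

/-- The basic Krasnosel'skiĭ–Mann descent: the relaxed point is a convex combination of `x` and `T
x`, and strict convexity of the squared norm yields the gain. -/
theorem norm_relaxed_sub_sq_le {T : E → E} (hT : LipschitzWith 1 T) {z : E} (hz : T z = z)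
    {t : ℝ} (ht : 0 ≤ t) (x : E) :
    ‖x + t • (T x - x) - z‖ ^ 2 ≤ ‖x - z‖ ^ 2 - t * (1 - t) * ‖T x - x‖ ^ 2 := by
  have h1 : ‖T x - z‖ ≤ ‖x - z‖ := by
    have := hT.norm_sub_le x z
    rwa [hz, NNReal.coe_one, one_mul] at this
  have h2 := mul_le_mul_of_nonneg_left (pow_le_pow_left₀ (norm_nonneg _) h1 2) ht
  have e : x + t • (T x - x) - z = (1 - t) • (x - z) + t • (T x - z) := by module
  rw [e, norm_sq_convexCombo, show x - z - (T x - z) = -(T x - x) by abel, norm_neg]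
  linarith

end Projection

/-! ### The weighted norm, its projection and its distance function. -/

section WeightedNorm

variable {m : ℕ} {H : Fin m → Type*} [∀ l, NormedAddCommGroup (H l)]
  {p : Fin m → ℝ}

theorem wnormSq_nonneg (hp : ∀ l, 0 < p l) (y : PiLp 2 H) : 0 ≤ wnormSq p y :=
  Finset.sum_nonneg fun l _ => mul_nonneg (one_div_pos.2 (hp l)).le (sq_nonneg _)

theorem wnormSq_le (hp : ∀ l, 0 < p l) (y : PiLp 2 H) :
    wnormSq p y ≤ (∑ l, 1 / p l) * ‖y‖ ^ 2 := by
  rw [wnormSq, PiLp.norm_sq_eq_of_L2, Finset.mul_sum]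
  refine Finset.sum_le_sum fun l _ => mul_le_mul_of_nonneg_right ?_ (sq_nonneg _)
  exact Finset.single_le_sum (f := fun l => 1 / p l)
    (fun l _ => (one_div_pos.2 (hp l)).le) (Finset.mem_univ l)

theorem norm_sq_le_wnormSq (hp : ∀ l, 0 < p l) (hp1 : ∀ l, p l ≤ 1) (y : PiLp 2 H) :
    ‖y‖ ^ 2 ≤ wnormSq p y := by
  rw [wnormSq, PiLp.norm_sq_eq_of_L2]
  refine Finset.sum_le_sum fun l _ => ?_
  have : 1 ≤ 1 / p l := (one_le_div (hp l)).2 (hp1 l)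
  nlinarith [sq_nonneg ‖y l‖]

theorem continuous_wnormSq : Continuous (wnormSq p : PiLp 2 H → ℝ) := by
  unfold wnormSq
  fun_prop

theorem mask_apply (c : Fin m → Bool) (e : PiLp 2 H) (l : Fin m) :
    mask c e l = if c l then e l else 0 := rfl

theorem norm_mask_le (c : Fin m → Bool) (e : PiLp 2 H) : ‖mask c e‖ ≤ ‖e‖ := by
  refine le_of_sq_le_sq ?_ (norm_nonneg _)
  rw [PiLp.norm_sq_eq_of_L2, PiLp.norm_sq_eq_of_L2]
  refine Finset.sum_le_sum fun l _ => ?_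
  rw [mask_apply]
  split_ifs
  · exact le_rfl
  · simp

theorem wnormSq_add_mask (c : Fin m → Bool) (u v : PiLp 2 H) :
    wnormSq p (u + mask c v) = wnormSq p u +
      ∑ l, (if c l then 1 / p l else 0) * (‖u l + v l‖ ^ 2 - ‖u l‖ ^ 2) := by
  rw [wnormSq, wnormSq, ← Finset.sum_add_distrib]
  refine Finset.sum_congr rfl fun l _ => ?_
  rw [PiLp.add_apply, mask_apply]
  split_ifs
  · ring
  · simp

variable [∀ l, InnerProductSpace ℝ (H l)]

/-- Multiplication of the `l`-th block by `c l`. -/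
def blockScale (c : Fin m → ℝ) (y : PiLp 2 H) : PiLp 2 H :=
  WithLp.toLp 2 fun l => c l • y l

@[simp]
theorem blockScale_apply (c : Fin m → ℝ) (y : PiLp 2 H) (l : Fin m) :
    blockScale c y l = c l • y l := rfl

theorem continuous_blockScale (c : Fin m → ℝ) :
    Continuous (blockScale c : PiLp 2 H → PiLp 2 H) := by
  unfold blockScale
  fun_prop

theorem blockScale_sub (c : Fin m → ℝ) (y z : PiLp 2 H) :
    blockScale c (y - z) = blockScale c y - blockScale c z := by
  ext l; simp [smul_sub]

theorem blockScale_combo (c : Fin m → ℝ) (s t : ℝ) (y z : PiLp 2 H) :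
    blockScale c (s • y + t • z) = s • blockScale c y + t • blockScale c z := by
  ext l; simp only [blockScale_apply, PiLp.add_apply, PiLp.smul_apply]; module

theorem blockScale_blockScale {c d : Fin m → ℝ} (h : ∀ l, c l * d l = 1) (y : PiLp 2 H) :
    blockScale c (blockScale d y) = y := by
  ext l; simp [smul_smul, h]

/-- Scaling the blocks is an isometry from the weighted norm to the Hilbert norm; Hilbert space
facts, projections included, are transported through it. -/
theorem wnormSq_eq_norm_sq (hp : ∀ l, 0 < p l) (y : PiLp 2 H) :
    wnormSq p y = ‖blockScale (fun l => (√(p l))⁻¹) y‖ ^ 2 := by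
  rw [PiLp.norm_sq_eq_of_L2, wnormSq]
  refine Finset.sum_congr rfl fun l _ => ?_
  rw [blockScale_apply, norm_smul, mul_pow, Real.norm_eq_abs, sq_abs, inv_pow,
    Real.sq_sqrt (hp l).le, one_div]

theorem wnormSq_add_le (hp : ∀ l, 0 < p l) {η : ℝ} (hη : 0 < η) (u v : PiLp 2 H) :
    wnormSq p (u + v) ≤ (1 + η) * wnormSq p u + (1 + 1 / η) * wnormSq p v := by
  simp only [wnormSq_eq_norm_sq hp]
  have := blockScale_combo (fun l => (√(p l))⁻¹) 1 1 u v
  simp only [one_smul] at this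
  rw [this]
  exact norm_add_sq_le_young hη _ _

theorem wnormSq_sum_smul_le {ι : Type*} [Fintype ι] (hp : ∀ l, 0 < p l) {a : ι → ℝ}
    (ha : ∀ j, 0 ≤ a j) (ha1 : ∑ j, a j = 1) (y : ι → PiLp 2 H) :
    wnormSq p (∑ j, a j • y j) ≤ ∑ j, a j * wnormSq p (y j) := by
  simp only [wnormSq_eq_norm_sq hp]
  have : blockScale (fun l => (√(p l))⁻¹) (∑ j, a j • y j) =
      ∑ j, a j • blockScale (fun l => (√(p l))⁻¹) (y j) := by
    ext l
    simp only [blockScale_apply, WithLp.ofLp_sum, WithLp.ofLp_smul, Finset.sum_apply,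
      Pi.smul_apply, Finset.smul_sum]
    exact Finset.sum_congr rfl fun j _ => smul_comm _ _ _
  rw [this]
  exact norm_sum_smul_sq_le ha ha1 _

/-- The projection onto `C` with respect to the weighted norm. -/
noncomputable def wproj (p : Fin m → ℝ) (C : Set (PiLp 2 H)) (y : PiLp 2 H) : PiLp 2 H :=
  blockScale (fun l => √(p l))
    (metricProj (blockScale (fun l => √(p l)) ⁻¹' C) (blockScale (fun l => (√(p l))⁻¹) y))

/-- The squared distance to `C` in the weighted norm. -/
noncomputable def wdistSq (p : Fin m → ℝ) (C : Set (PiLp 2 H)) (y : PiLp 2 H) : ℝ :=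
  wnormSq p (y - wproj p C y)

variable {C : Set (PiLp 2 H)}

theorem nonempty_preimage_blockScale (hp : ∀ l, 0 < p l) (hne : C.Nonempty) :
    (blockScale (fun l => √(p l)) ⁻¹' C).Nonempty := by
  obtain ⟨z, hz⟩ := hne
  refine ⟨blockScale (fun l => (√(p l))⁻¹) z, ?_⟩
  rw [Set.mem_preimage, blockScale_blockScale]
  · exact hz
  · exact fun l => mul_inv_cancel₀ (Real.sqrt_pos.2 (hp l)).ne'

theorem convex_preimage_blockScale (hcv : Convex ℝ C) (c : Fin m → ℝ) :
    Convex ℝ (blockScale c ⁻¹' C) := by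
  intro x hx y hy s t hs ht hst
  rw [Set.mem_preimage, blockScale_combo]
  exact hcv hx hy hs ht hst

theorem wdistSq_nonneg (hp : ∀ l, 0 < p l) (y : PiLp 2 H) : 0 ≤ wdistSq p C y :=
  wnormSq_nonneg hp _

variable [∀ l, CompleteSpace (H l)]

theorem wproj_mem (hp : ∀ l, 0 < p l) (hne : C.Nonempty) (hcl : IsClosed C) (hcv : Convex ℝ C)
    (y : PiLp 2 H) : wproj p C y ∈ C :=
  (metricProj_spec (nonempty_preimage_blockScale hp hne)
    (hcl.preimage (continuous_blockScale _)) (convex_preimage_blockScale hcv _) _).1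

theorem continuous_wproj (hp : ∀ l, 0 < p l) (hne : C.Nonempty) (hcl : IsClosed C)
    (hcv : Convex ℝ C) : Continuous (wproj p C) :=
  (continuous_blockScale _).comp
    ((lipschitzWith_metricProj (nonempty_preimage_blockScale hp hne)
      (hcl.preimage (continuous_blockScale _)) (convex_preimage_blockScale hcv _)).continuous.comp
      (continuous_blockScale _))

theorem wdistSq_le (hp : ∀ l, 0 < p l) (hne : C.Nonempty) (hcl : IsClosed C) (hcv : Convex ℝ C)
    (y : PiLp 2 H) {z : PiLp 2 H} (hz : z ∈ C) : wdistSq p C y ≤ wnormSq p (y - z) := by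
  have hs : ∀ l, √(p l) ≠ 0 := fun l => (Real.sqrt_pos.2 (hp l)).ne'
  rw [wdistSq, wnormSq_eq_norm_sq hp, wnormSq_eq_norm_sq hp, blockScale_sub, blockScale_sub, wproj,
    blockScale_blockScale (fun l => inv_mul_cancel₀ (hs l)),
    (metricProj_spec (nonempty_preimage_blockScale hp hne)
    (hcl.preimage (continuous_blockScale _)) (convex_preimage_blockScale hcv _) _).2]
  refine pow_le_pow_left₀ Metric.infDist_nonneg ?_ 2
  rw [← dist_eq_norm]
  refine Metric.infDist_le_dist_of_mem ?_
  rw [Set.mem_preimage, blockScale_blockScale (fun l => mul_inv_cancel₀ (hs l))]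
  exact hz

theorem continuous_wdistSq (hp : ∀ l, 0 < p l) (hne : C.Nonempty) (hcl : IsClosed C)
    (hcv : Convex ℝ C) : Continuous (wdistSq p C) :=
  continuous_wnormSq.comp (continuous_id.sub (continuous_wproj hp hne hcl hcv))

/-- The average of the projections lies in the convex set `C` and competes with the projection of
the average. -/
theorem wdistSq_sum_smul_le {ι : Type*} [Fintype ι] (hp : ∀ l, 0 < p l) (hne : C.Nonempty)
    (hcl : IsClosed C) (hcv : Convex ℝ C) {a : ι → ℝ}
    (ha : ∀ j, 0 ≤ a j) (ha1 : ∑ j, a j = 1) (y : ι → PiLp 2 H) :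
    wdistSq p C (∑ j, a j • y j) ≤ ∑ j, a j * wdistSq p C (y j) := by
  refine (wdistSq_le hp hne hcl hcv _ (z := ∑ j, a j • wproj p C (y j))
    (hcv.sum_mem (fun j _ => ha j) ha1 fun j _ => wproj_mem hp hne hcl hcv _)).trans ?_
  rw [← Finset.sum_sub_distrib]
  simp only [← smul_sub]
  exact wnormSq_sum_smul_le hp ha ha1 _

theorem wdistSq_add_le (hp : ∀ l, 0 < p l) (hne : C.Nonempty) (hcl : IsClosed C)
    (hcv : Convex ℝ C) {η : ℝ} (hη : 0 < η) (y e : PiLp 2 H) :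
    wdistSq p C (y + e) ≤ (1 + η) * wdistSq p C y + (1 + 1 / η) * wnormSq p e := by
  refine (wdistSq_le hp hne hcl hcv _ (wproj_mem hp hne hcl hcv y)).trans ?_
  rw [add_sub_right_comm]
  exact wnormSq_add_le hp hη _ _

theorem wdistSq_le_infDist (hp : ∀ l, 0 < p l) (hne : C.Nonempty) (hcl : IsClosed C)
    (hcv : Convex ℝ C) (y : PiLp 2 H) :
    wdistSq p C y ≤ (∑ l, 1 / p l) * Metric.infDist y C ^ 2 := by
  obtain ⟨h1, h2⟩ := metricProj_spec hne hcl hcv y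
  rw [← h2]
  exact (wdistSq_le hp hne hcl hcv y h1).trans (wnormSq_le hp _)

theorem infDist_sq_le_wdistSq (hp : ∀ l, 0 < p l) (hp1 : ∀ l, p l ≤ 1) (hne : C.Nonempty)
    (hcl : IsClosed C) (hcv : Convex ℝ C) (y : PiLp 2 H) :
    Metric.infDist y C ^ 2 ≤ wdistSq p C y := by
  refine le_trans (pow_le_pow_left₀ Metric.infDist_nonneg ?_ 2) (norm_sq_le_wnormSq hp hp1 _)
  rw [← dist_eq_norm]
  exact Metric.infDist_le_dist_of_mem (wproj_mem hp hne hcl hcv y)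

end WeightedNorm

/-! ### Disagreement in a perturbed consensus recursion. -/

section Consensus

variable {N : ℕ} {A : ℕ → Matrix (Fin N) (Fin N) ℝ} {w : ℕ → Fin N → ℝ} {ϖ ξ wmin : ℝ}
  {E : Type*} [NormedAddCommGroup E] [NormedSpace ℝ E]

/-- A geometric bound for the disagreement of a perturbed consensus recursion. -/
noncomputable def disagreementBound (A : ℕ → Matrix (Fin N) (Fin N) ℝ) (ϖ ξ : ℝ)
    (x : Fin N → ℕ → E) : ℕ → ℝ
  | 0 => ϖ * ∑ j, ‖x j 0‖
  | k + 1 => ξ * disagreementBound A ϖ ξ x k +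
      ϖ * ∑ j, ‖x j (k + 1) - ∑ l, A k j l • x l k‖

/-- Invariance of `w` gives `(transMat A (k+1) n - 1 w(k+1)ᵀ) A k = transMat A k (n+1) - 1 w(k)ᵀ`.
One time step thus trades `k` for a longer product, plus a fresh increment; this is why `n` is
arbitrary in the induction. Only `n = 0` is used later. -/
theorem norm_transMat_sub_le (hw : IsMixing A w ϖ ξ wmin) (x : Fin N → ℕ → E) (k n : ℕ)
    (i : Fin N) :
    ‖∑ j, (transMat A k n i j - w k j) • x j k‖ ≤ ξ ^ n * disagreementBound A ϖ ξ x k := by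
  have hb : ∀ (k n : ℕ) (v : Fin N → E),
      ‖∑ j, (transMat A k n i j - w k j) • v j‖ ≤ ξ ^ n * (ϖ * ∑ j, ‖v j‖) := by
    intro k n v
    refine (norm_sum_le _ _).trans ?_
    rw [← mul_assoc, mul_comm (ξ ^ n), Finset.mul_sum]
    refine Finset.sum_le_sum fun j _ => ?_
    rw [norm_smul, Real.norm_eq_abs]
    exact mul_le_mul_of_nonneg_right (hw.geometric k n i j) (norm_nonneg _)
  induction k generalizing n with
  | zero => exact hb 0 n _
  | succ k ih =>
    have e : ∑ j, (transMat A (k + 1) n i j - w (k + 1) j) • x j (k + 1) =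
        ∑ j, (transMat A k (n + 1) i j - w k j) • x j k +
        ∑ j, (transMat A (k + 1) n i j - w (k + 1) j) •
          (x j (k + 1) - ∑ l, A k j l • x l k) := by
      have e1 : ∀ l, transMat A k (n + 1) i l - w k l =
          ∑ j, (transMat A (k + 1) n i j - w (k + 1) j) * A k j l := by
        intro l
        rw [transMat_succ_right, hw.invariant k]
        simp only [Matrix.mul_apply, Matrix.vecMul, dotProduct, sub_mul, Finset.sum_sub_distrib]
      simp only [e1, Finset.sum_smul]
      rw [Finset.sum_comm, ← Finset.sum_add_distrib]
      refine Finset.sum_congr rfl fun j _ => ?_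
      simp only [mul_smul]
      rw [← Finset.smul_sum, ← smul_add, add_sub_cancel]
    rw [e]
    refine (norm_add_le _ _).trans ((add_le_add (ih (n + 1)) (hb (k + 1) n _)).trans_eq ?_)
    rw [disagreementBound]
    ring

theorem norm_sub_mean_le (hw : IsMixing A w ϖ ξ wmin) (x : Fin N → ℕ → E) (k : ℕ) (i : Fin N) :
    ‖x i k - ∑ j, w k j • x j k‖ ≤ disagreementBound A ϖ ξ x k := by
  have := norm_transMat_sub_le hw x k 0 i
  simpa [transMat, sub_smul, Matrix.one_apply, Finset.sum_sub_distrib] using this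

theorem norm_sub_le_two_mul_disagreementBound (hw : IsMixing A w ϖ ξ wmin) (x : Fin N → ℕ → E)
    (k : ℕ) (i j : Fin N) : ‖x i k - x j k‖ ≤ 2 * disagreementBound A ϖ ξ x k := by
  have h1 := norm_sub_mean_le hw x k i
  have h2 := norm_sub_mean_le hw x k j
  have h3 := norm_sub_le_norm_sub_add_norm_sub (x i k) (∑ l, w k l • x l k) (x j k)
  rw [norm_sub_rev (∑ l, w k l • x l k)] at h3
  linarith

theorem norm_sub_sum_smul_le {ι : Type*} [Fintype ι] {a : ι → ℝ} (ha : ∀ j, 0 ≤ a j)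
    (ha1 : ∑ j, a j = 1) (y : E) (v : ι → E) {r : ℝ} (h : ∀ j, ‖y - v j‖ ≤ r) :
    ‖y - ∑ j, a j • v j‖ ≤ r := by
  have e : y - ∑ j, a j • v j = ∑ j, a j • (y - v j) := by
    simp only [smul_sub, Finset.sum_sub_distrib, ← Finset.sum_smul, ha1, one_smul]
  rw [e]
  calc _ ≤ ∑ j, a j * r := (norm_sum_le _ _).trans (Finset.sum_le_sum fun j _ => by
          rw [norm_smul, Real.norm_of_nonneg (ha j)]
          exact mul_le_mul_of_nonneg_left (h j) (ha j))
    _ = r := by rw [← Finset.sum_mul, ha1, one_mul]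

end Consensus

/-! ### Scalar recursions and the Lyapunov combination. -/

section Recursion

theorem le_geometric_add_const {L : ℕ → ℝ} {ρ δ : ℝ} {k₀ : ℕ} (hρ : 0 ≤ ρ)
    (h : ∀ k, k₀ ≤ k → L (k + 1) ≤ ρ * L k + (1 - ρ) * δ) (n : ℕ) :
    L (k₀ + n) ≤ δ + ρ ^ n * (L k₀ - δ) := by
  induction n with
  | zero => simp
  | succ n ih =>
    have h1 := h (k₀ + n) (Nat.le_add_right _ _)
    have h2 := mul_le_mul_of_nonneg_left ih hρ
    rw [← add_assoc, pow_succ]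
    linarith

theorem tendsto_zero_of_le_mul_add {L e : ℕ → ℝ} {ρ : ℝ} (hρ0 : 0 ≤ ρ) (hρ1 : ρ < 1)
    (hL : ∀ k, 0 ≤ L k) (he : Tendsto e atTop (𝓝 0)) (h : ∀ k, L (k + 1) ≤ ρ * L k + e k) :
    Tendsto L atTop (𝓝 0) := by
  rw [Metric.tendsto_atTop]
  intro δ hδ
  have hpos : 0 < (1 - ρ) * (δ / 2) := mul_pos (by linarith) (by linarith)
  obtain ⟨k₀, hk₀⟩ := eventually_atTop.1 (he.eventually (gt_mem_nhds hpos))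
  have hg := le_geometric_add_const (L := L) (δ := δ / 2) (k₀ := k₀) hρ0 fun k hk =>
    (h k).trans (by linarith [hk₀ k hk])
  have ht : Tendsto (fun n : ℕ => ρ ^ n * (L k₀ - δ / 2)) atTop (𝓝 0) := by
    simpa using (tendsto_pow_atTop_nhds_zero_of_lt_one hρ0 hρ1).mul_const (L k₀ - δ / 2)
  obtain ⟨n₀, hn₀⟩ := eventually_atTop.1 (ht.eventually (gt_mem_nhds (half_pos hδ)))
  refine ⟨k₀ + n₀, fun k hk => ?_⟩
  obtain ⟨n, rfl⟩ := Nat.exists_eq_add_of_le (show k₀ ≤ k by omega)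
  rw [Real.dist_eq, sub_zero, abs_of_nonneg (hL _)]
  linarith [hg n, hn₀ n (by omega)]

/-- Writing `ρ ^ k = exp (k log ρ)` with `log ρ < 0`, exponential decay beats every power, so `s` is
arbitrary. -/
theorem isBigO_pow_one_div_rpow {ρ : ℝ} (hρ0 : 0 < ρ) (hρ1 : ρ < 1) (s : ℝ) :
    (fun k : ℕ => ρ ^ k) =O[atTop] fun k : ℕ => 1 / (k : ℝ) ^ s := by
  have h := (isLittleO_exp_neg_mul_rpow_atTop (a := -Real.log ρ)
    (by linarith [Real.log_neg hρ0 hρ1]) (-s)).isBigO.comp_tendsto tendsto_natCast_atTop_atTop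
  refine (h.congr' ?_ ?_)
  · refine Eventually.of_forall fun k => ?_
    simp only [Function.comp_apply, neg_neg]
    rw [mul_comm, Real.exp_nat_mul, Real.exp_log hρ0]
  · refine Eventually.of_forall fun k => ?_
    simp only [Function.comp_apply]
    rw [Real.rpow_neg (Nat.cast_nonneg k), one_div]

/-- Weights that turn the coupled recursions for the distance and the disagreement into a single
linear contraction. -/
theorem exists_lyapunov_weights {c C₀ C₁ C₂ ξ : ℝ} (hc : 0 < c) (hC₀ : 0 ≤ C₀) (hC₁ : 0 < C₁)
    (hC₂ : 0 < C₂) (hξ0 : 0 < ξ) (hξ1 : ξ < 1) :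
    ∃ η β ρ K : ℝ, 0 < η ∧ 0 < β ∧ 0 < ρ ∧ ρ < 1 ∧ 0 ≤ K ∧ ∀ D Φ R e D' Φ' : ℝ,
      0 ≤ D → 0 ≤ Φ → 0 ≤ R →
      D' ≤ (1 + η) * (D - c * R) + (1 + 1 / η) * (C₀ * e) → Φ' ≤ ξ * Φ + C₁ * (R + e) →
      D ≤ C₂ * (R + Φ) → D' + β * Φ' ≤ ρ * (D + β * Φ) + K * e := by
  -- With `β * C₁ = c / 2`, the residual entering through `β * Φ'` uses up only half of the descent
  -- `c * R`.
  set β := c / (2 * C₁) with hβ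
  have hβ0 : 0 < β := by positivity
  have hβC : β * C₁ = c / 2 := by rw [hβ]; field_simp
  -- What remains is `c / 2` of `R` and half of the contraction margin of `β * Φ`; both are at least
  -- `θ`.
  set θ := min (c / 2) (β * (1 - ξ) / 2) with hθ
  have hθ0 : 0 < θ := lt_min (by linarith) (by
    have : 0 < 1 - ξ := by linarith
    positivity)
  have hθ1 : θ ≤ c / 2 := min_le_left _ _
  have hθ2 : θ ≤ β * (1 - ξ) / 2 := min_le_right _ _
  -- The spare `θ * (R + Φ)` is then at least `2 * η * D`: one `η * D` cancels the growth caused by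
  -- Young's inequality, the other gives the contraction of `D`.
  set η := θ / (2 * C₂) with hη
  have hη0 : 0 < η := by positivity
  have hηC : 2 * η * C₂ = θ := by rw [hη]; field_simp
  refine ⟨η, β, max (1 - η) ((1 + ξ) / 2), (1 + 1 / η) * C₀ + β * C₁, hη0, hβ0,
    lt_max_of_lt_right (by linarith), max_lt (by linarith) (by linarith), by positivity, ?_⟩
  intro D Φ R e D' Φ' hD hΦ hR h1 h2 h3
  set ρ := max (1 - η) ((1 + ξ) / 2)
  have hρ1 : (1 - η) * D ≤ ρ * D := mul_le_mul_of_nonneg_right (le_max_left _ _) hD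
  have hρ2 : (1 + ξ) / 2 * (β * Φ) ≤ ρ * (β * Φ) :=
    mul_le_mul_of_nonneg_right (le_max_right _ _) (by positivity)
  have h4 : 2 * η * D ≤ θ * (R + Φ) := by
    rw [← hηC, mul_assoc]
    calc 2 * (η * D) ≤ 2 * (η * (C₂ * (R + Φ))) := by gcongr
      _ = _ := by ring
  have h5 : θ * R ≤ c / 2 * R := mul_le_mul_of_nonneg_right hθ1 hR
  have h6 : θ * Φ ≤ β * (1 - ξ) / 2 * Φ := mul_le_mul_of_nonneg_right hθ2 hΦ
  have h7 : 0 ≤ η * (c * R) := by positivity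
  have h8 := mul_le_mul_of_nonneg_left h2 hβ0.le
  have h9 : β * (C₁ * R) = c / 2 * R := by rw [← mul_assoc, hβC]
  nlinarith

/-- Convexity of the square, with weights `ξ` and `1 - ξ` at the points `s` and `t / (1 - ξ)`. -/
theorem contraction_add_sq_le {ξ : ℝ} (hξ0 : 0 ≤ ξ) (hξ1 : ξ < 1) (s t : ℝ) :
    (ξ * s + t) ^ 2 ≤ ξ * s ^ 2 + t ^ 2 / (1 - ξ) := by
  have h : 0 < 1 - ξ := by linarith
  have e : ξ * s ^ 2 + t ^ 2 / (1 - ξ) - (ξ * s + t) ^ 2 =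
      ξ * ((1 - ξ) * s - t) ^ 2 / (1 - ξ) := by
    field_simp; ring
  have : 0 ≤ ξ * ((1 - ξ) * s - t) ^ 2 / (1 - ξ) := by positivity
  linarith

theorem sum_sq_le_card_mul {N : ℕ} (f : Fin N → ℝ) : (∑ i, f i) ^ 2 ≤ N * ∑ i, f i ^ 2 := by
  simpa using sq_sum_le_card_mul_sum_sq (s := Finset.univ) (f := f)

end Recursion

/-! ### Square integrability and averaging over random activations. -/

section SecondMoments

variable {Ω : Type*} [MeasurableSpace Ω] {P : Measure Ω} {E : Type*} [NormedAddCommGroup E]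

theorem MeasureTheory.MemLp.integrable_norm_sq {f : Ω → E} (hf : MemLp f 2 P) :
    Integrable (fun ω => ‖f ω‖ ^ 2) P := by
  simpa using hf.integrable_norm_pow (p := 2) two_ne_zero

theorem LipschitzWith.memLp_two_comp [IsFiniteMeasure P] {T : E → E} (hT : LipschitzWith 1 T)
    {f : Ω → E} (hf : MemLp f 2 P) : MemLp (fun ω => T (f ω)) 2 P := by
  have h : MemLp (fun ω => T (f ω) - T 0) 2 P := by
    refine hf.of_le ((hT.continuous.comp_aestronglyMeasurable hf.1).sub
      aestronglyMeasurable_const) (Eventually.of_forall fun ω => ?_)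
    simpa using hT.norm_sub_le (f ω) 0
  refine (memLp_congr_ae (Eventually.of_forall fun ω => ?_)).1 (h.add (memLp_const (T 0)))
  simp

variable {m : ℕ} {H : Fin m → Type*} [∀ l, NormedAddCommGroup (H l)]
  {p : Fin m → ℝ}

theorem integrable_wnormSq (hp : ∀ l, 0 < p l) {u : Ω → PiLp 2 H} (hu : MemLp u 2 P) :
    Integrable (fun ω => wnormSq p (u ω)) P := by
  refine (hu.integrable_norm_sq.const_mul (∑ l, 1 / p l)).mono'
    (continuous_wnormSq.comp_aestronglyMeasurable hu.1) (Eventually.of_forall fun ω => ?_)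
  rw [Real.norm_of_nonneg (wnormSq_nonneg hp _)]
  exact wnormSq_le hp _

variable [∀ l, MeasurableSpace (H l)]

theorem Measurable.mask {B : Ω → Fin m → Bool} {u : Ω → PiLp 2 H} (hB : Measurable B)
    (hu : Measurable u) : Measurable fun ω => mask (B ω) (u ω) := by
  refine (WithLp.measurable_toLp 2 _).comp (measurable_pi_iff.2 fun l => ?_)
  refine Measurable.ite ?_ ?_ measurable_const
  · exact ((measurable_pi_apply l).comp hB) (measurableSet_singleton true)
  · exact (measurable_pi_apply l).comp ((WithLp.measurable_ofLp 2 _).comp hu)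

variable [∀ l, SecondCountableTopology (H l)] [∀ l, BorelSpace (H l)]

theorem memLp_mask {B : Ω → Fin m → Bool} {u : Ω → PiLp 2 H} (hB : Measurable B)
    (hu : Measurable u) (hu2 : MemLp u 2 P) : MemLp (fun ω => mask (B ω) (u ω)) 2 P :=
  hu2.of_le (hB.mask hu).aestronglyMeasurable (Eventually.of_forall fun _ => norm_mask_le _ _)

/-- Averaging over independent activations replaces the weighted norm of the increment by the
plain norm. -/
theorem integral_wnormSq_add_mask {B : Ω → Fin m → Bool} {u v : Ω → PiLp 2 H}
    [IsFiniteMeasure P] (hB : Measurable B) (hu : Measurable u) (hv : Measurable v)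
    (hind : IndepFun B (fun ω => (u ω, v ω)) P)
    (hBp : ∀ l, P.real {ω | B ω l = true} = p l) (hp : ∀ l, 0 < p l)
    (hu2 : MemLp u 2 P) (hv2 : MemLp v 2 P) :
    ∫ ω, wnormSq p (u ω + mask (B ω) (v ω)) ∂P =
      ∫ ω, wnormSq p (u ω) ∂P + ∫ ω, (‖u ω + v ω‖ ^ 2 - ‖u ω‖ ^ 2) ∂P := by
  have hcoord : ∀ {f : Ω → PiLp 2 H}, Measurable f → MemLp f 2 P → ∀ l,
      Integrable (fun ω => ‖f ω l‖ ^ 2) P := by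
    intro f hf hf2 l
    have hm : Measurable fun ω => f ω l :=
      (measurable_pi_apply l).comp ((WithLp.measurable_ofLp 2 _).comp hf)
    exact (hf2.of_le (g := f) (f := fun ω => f ω l) hm.aestronglyMeasurable
      (Eventually.of_forall fun ω => PiLp.norm_apply_le (f ω) l)).integrable_norm_sq
  have hg : ∀ l, Integrable (fun ω => ‖u ω l + v ω l‖ ^ 2 - ‖u ω l‖ ^ 2) P := fun l =>
    (hcoord (hu.add hv) (hu2.add hv2) l).sub (hcoord hu hu2 l)
  let φ : Fin m → (Fin m → Bool) → ℝ := fun l c => if c l then 1 / p l else 0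
  let ψ : Fin m → PiLp 2 H × PiLp 2 H → ℝ := fun l z => ‖z.1 l + z.2 l‖ ^ 2 - ‖z.1 l‖ ^ 2
  have hφ : ∀ l, Measurable (φ l) := fun l => measurable_of_countable _
  have hψ : ∀ l, Measurable (ψ l) := fun l => by
    have h1 : Measurable fun z : PiLp 2 H × PiLp 2 H => z.1 l :=
      (measurable_pi_apply l).comp ((WithLp.measurable_ofLp 2 _).comp measurable_fst)
    have h2 : Measurable fun z : PiLp 2 H × PiLp 2 H => z.2 l :=
      (measurable_pi_apply l).comp ((WithLp.measurable_ofLp 2 _).comp measurable_snd)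
    exact ((h1.add h2).norm.pow_const 2).sub (h1.norm.pow_const 2)
  have hset : ∀ l, MeasurableSet {ω | B ω l = true} := fun l =>
    ((measurable_pi_apply l).comp hB) (measurableSet_singleton true)
  have hφi : ∀ l, (fun ω => φ l (B ω)) = Set.indicator {ω | B ω l = true} fun _ => 1 / p l := by
    intro l
    funext ω
    simp only [φ, Set.indicator_apply, Set.mem_ofPred_eq]
  have hφint : ∀ l, Integrable (fun ω => φ l (B ω)) P := fun l => by
    rw [hφi]
    exact (integrable_const _).indicator (hset l)
  -- The weights `1 / p l` of the norm exactly compensate the activation probabilities.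
  have hφ1 : ∀ l, ∫ ω, φ l (B ω) ∂P = 1 := fun l => by
    rw [hφi, integral_indicator_const _ (hset l), hBp, smul_eq_mul, mul_one_div,
      div_self (hp l).ne']
  have hi : ∀ l, IndepFun (fun ω => φ l (B ω)) (fun ω => ψ l (u ω, v ω)) P := fun l =>
    hind.comp (hφ l) (hψ l)
  have hprod : ∀ l, Integrable (fun ω => φ l (B ω) * ψ l (u ω, v ω)) P := fun l =>
    (hi l).integrable_mul (hφint l) (hg l)
  have hval : ∀ l, ∫ ω, φ l (B ω) * ψ l (u ω, v ω) ∂P = ∫ ω, ψ l (u ω, v ω) ∂P := fun l => by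
    rw [hind.integral_fun_comp_mul_comp hB.aemeasurable (hu.prodMk hv).aemeasurable
      (hφ l).aestronglyMeasurable (hψ l).aestronglyMeasurable, hφ1, one_mul]
  calc _ = ∫ ω, (wnormSq p (u ω) + ∑ l, φ l (B ω) * ψ l (u ω, v ω)) ∂P := by
        simp only [wnormSq_add_mask]; rfl
    _ = ∫ ω, wnormSq p (u ω) ∂P + ∑ l, ∫ ω, ψ l (u ω, v ω) ∂P := by
        rw [integral_add (integrable_wnormSq hp hu2) (integrable_finsetSum _ fun l _ => hprod l),
          integral_finsetSum _ fun l _ => hprod l]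
        simp only [hval]
    _ = _ := by
        rw [← integral_finsetSum _ fun l _ => hg l]
        congr 1
        refine integral_congr_ae (Eventually.of_forall fun ω => ?_)
        simp only [PiLp.norm_sq_eq_of_L2, ← Finset.sum_sub_distrib, PiLp.add_apply]

end SecondMoments

/-! ### Pathwise bounds by residuals and disagreement. -/

section Pathwise

variable {N m : ℕ} {H : Fin m → Type*} [∀ l, NormedAddCommGroup (H l)]
  [∀ l, InnerProductSpace ℝ (H l)] {Ω : Type*} {F : Fin N → PiLp 2 H → PiLp 2 H}
  {A : ℕ → Matrix (Fin N) (Fin N) ℝ} {p : Fin m → ℝ} {x : Fin N → ℕ → Ω → PiLp 2 H}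
  {w : ℕ → Fin N → ℝ} {ϖ ξ wmin ν : ℝ}

theorem norm_state_sub_aggregate_le (hA : ConnectivityAndWeights A)
    (hw : IsMixing A w ϖ ξ wmin) (i j : Fin N) (k : ℕ) (ω : Ω) :
    ‖x j k ω - aggregate A x i k ω‖ ≤
      2 * disagreementBound A ϖ ξ (fun j t => x j t ω) k :=
  norm_sub_sum_smul_le (hA.nonneg k i) (hA.row_sum k i) _ _ fun l =>
    norm_sub_le_two_mul_disagreementBound hw (fun j t => x j t ω) k j l

variable [∀ l, CompleteSpace (H l)]

/-- Regularity bounds the distance by the fixed-point residuals and the disagreement. -/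
theorem wdistSq_state_le (hF : ∀ i, LipschitzWith 1 (F i)) (hne : (commonFix F).Nonempty)
    (hp : ∀ l, 0 < p l) (hA : ConnectivityAndWeights A) (hw : IsMixing A w ϖ ξ wmin)
    (j : Fin N) (k : ℕ) (ω : Ω)
    (h : Metric.infDist (x j k ω) (commonFix F) ≤ ν * ∑ i, ‖F i (x j k ω) - x j k ω‖) :
    wdistSq p (commonFix F) (x j k ω) ≤ (∑ l, 1 / p l) * (32 * N ^ 2 * ν ^ 2) *
      (∑ i, ‖F i (aggregate A x i k ω) - aggregate A x i k ω‖ ^ 2 +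
        disagreementBound A ϖ ξ (fun j t => x j t ω) k ^ 2) := by
  set φ := disagreementBound A ϖ ξ (fun j t => x j t ω) k
  set R := fun i => ‖F i (aggregate A x i k ω) - aggregate A x i k ω‖
  have hN : (1 : ℝ) ≤ N := by exact_mod_cast j.pos
  -- Regularity needs all operators at the same point, whereas `R i` is taken at the aggregate of
  -- agent `i`. Residuals are 2-Lipschitz and the two points are at most `2 * φ` apart, whence `4 *
  -- φ`.
  have h1 : ∑ i, ‖F i (x j k ω) - x j k ω‖ ≤ ∑ i, (R i + 4 * φ) := by
    refine Finset.sum_le_sum fun i _ => ?_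
    have a1 := norm_residual_le (hF i) (x j k ω) (aggregate A x i k ω)
    have a2 := norm_state_sub_aggregate_le (x := x) hA hw i j k ω
    simp only [R]
    linarith
  have h2 : (∑ i, ‖F i (x j k ω) - x j k ω‖) ^ 2 ≤ N * ∑ i, (2 * R i ^ 2 + 32 * φ ^ 2) := by
    refine (pow_le_pow_left₀ (Finset.sum_nonneg fun _ _ => norm_nonneg _) h1 2).trans
      ((sum_sq_le_card_mul _).trans (mul_le_mul_of_nonneg_left
        (Finset.sum_le_sum fun i _ => ?_) (Nat.cast_nonneg _)))
    refine add_sq_le.trans_eq ?_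
    ring
  have h3 : (N : ℝ) * ∑ i, (2 * R i ^ 2 + 32 * φ ^ 2) ≤
      32 * N ^ 2 * (∑ i, R i ^ 2 + φ ^ 2) := by
    rw [Finset.sum_add_distrib, ← Finset.mul_sum, Finset.sum_const, Finset.card_univ,
      Fintype.card_fin, nsmul_eq_mul]
    have : 0 ≤ ∑ i, R i ^ 2 := Finset.sum_nonneg fun _ _ => sq_nonneg _
    have h4 : (N : ℝ) * ∑ i, R i ^ 2 ≤ N ^ 2 * ∑ i, R i ^ 2 :=
      mul_le_mul_of_nonneg_right (by nlinarith) this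
    have h5 : 0 ≤ (N : ℝ) ^ 2 * ∑ i, R i ^ 2 := by positivity
    nlinarith
  refine (wdistSq_le_infDist hp hne (isClosed_commonFix hF) (convex_commonFix hF) _).trans ?_
  rw [mul_assoc]
  refine mul_le_mul_of_nonneg_left ?_ (Finset.sum_nonneg fun l _ => (one_div_pos.2 (hp l)).le)
  calc _ ≤ (ν * ∑ i, ‖F i (x j k ω) - x j k ω‖) ^ 2 :=
        pow_le_pow_left₀ Metric.infDist_nonneg h 2
    _ ≤ ν ^ 2 * (32 * N ^ 2 * (∑ i, R i ^ 2 + φ ^ 2)) := by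
        rw [mul_pow]
        exact mul_le_mul_of_nonneg_left (h2.trans h3) (sq_nonneg _)
    _ = _ := by ring

/-- By convexity it suffices to compare `x i k` with each projection separately; passing through `x
j k` splits this into disagreement and distance to the fixed points. -/
theorem wnormSq_sub_weightedProj_le (hF : ∀ i, LipschitzWith 1 (F i))
    (hne : (commonFix F).Nonempty) (hp : ∀ l, 0 < p l) (hp1 : ∀ l, p l ≤ 1)
    (hw : IsMixing A w ϖ ξ wmin) (i : Fin N) (k : ℕ) (ω : Ω) :
    wnormSq p (x i k ω - weightedProj F w x k ω) ≤ (∑ l, 1 / p l) *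
      (8 * disagreementBound A ϖ ξ (fun j t => x j t ω) k ^ 2 +
        2 * ∑ j, w k j * wdistSq p (commonFix F) (x j k ω)) := by
  have hcl := isClosed_commonFix hF
  have hcv := convex_commonFix hF
  have hwnn : ∀ j, 0 ≤ w k j := fun j => hw.wmin_pos.le.trans (hw.lower k j)
  set φ := disagreementBound A ϖ ξ (fun j t => x j t ω) k
  refine (wnormSq_le hp _).trans (mul_le_mul_of_nonneg_left ?_
    (Finset.sum_nonneg fun l _ => (one_div_pos.2 (hp l)).le))
  have e : x i k ω - weightedProj F w x k ω =
      ∑ j, w k j • (x i k ω - metricProj (commonFix F) (x j k ω)) := by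
    simp only [smul_sub, Finset.sum_sub_distrib, ← Finset.sum_smul, hw.sum_eq_one, one_smul,
      weightedProj]
  rw [e]
  refine (norm_sum_smul_sq_le hwnn (hw.sum_eq_one k) _).trans ?_
  calc _ ≤ ∑ j, w k j * (8 * φ ^ 2 + 2 * wdistSq p (commonFix F) (x j k ω)) := by
        refine Finset.sum_le_sum fun j _ => mul_le_mul_of_nonneg_left ?_ (hwnn j)
        have h1 := norm_sub_le_two_mul_disagreementBound hw (fun j t => x j t ω) k i j
        have h2 := (metricProj_spec hne hcl hcv (x j k ω)).2
        have h3 := infDist_sq_le_wdistSq hp hp1 hne hcl hcv (x j k ω)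
        have h4 := norm_sub_le_norm_sub_add_norm_sub (x i k ω) (x j k ω)
          (metricProj (commonFix F) (x j k ω))
        rw [h2] at h4
        have h5 := (pow_le_pow_left₀ (norm_nonneg _) h4 2).trans add_sq_le
        have h6 := pow_le_pow_left₀ (norm_nonneg _) h1 2
        rw [mul_pow] at h6
        linarith
    _ = _ := by
        simp only [mul_add, Finset.sum_add_distrib, ← Finset.sum_mul, hw.sum_eq_one, one_mul,
          Finset.mul_sum]
        congr 1
        exact Finset.sum_congr rfl fun j _ => by ring

end Pathwise

/-! ### Square integrability along the iteration. -/

section Integrability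

variable {N m : ℕ} {H : Fin m → Type*} [∀ l, NormedAddCommGroup (H l)]
  [∀ l, InnerProductSpace ℝ (H l)] {Ω : Type*} [MeasurableSpace Ω] {P : Measure Ω}
  {F : Fin N → PiLp 2 H → PiLp 2 H} {A : ℕ → Matrix (Fin N) (Fin N) ℝ} {p : Fin m → ℝ}
  {x : Fin N → ℕ → Ω → PiLp 2 H} {w : ℕ → Fin N → ℝ}

theorem memLp_aggregate {k : ℕ} (h : ∀ j, MemLp (x j k) 2 P) (i : Fin N) :
    MemLp (aggregate A x i k) 2 P :=
  memLp_finsetSum _ fun j _ => (h j).const_smul (A k i j)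

theorem memLp_residual [IsFiniteMeasure P] (hF : ∀ i, LipschitzWith 1 (F i)) {k : ℕ}
    (h : ∀ j, MemLp (x j k) 2 P) (i : Fin N) :
    MemLp (fun ω => F i (aggregate A x i k ω) - aggregate A x i k ω) 2 P :=
  ((hF i).memLp_two_comp (memLp_aggregate h i)).sub (memLp_aggregate h i)

/-- The pathwise disagreement bound is square integrable. -/
theorem memLp_disagreementBound (h : ∀ k i, MemLp (x i k) 2 P) (ϖ ξ : ℝ)
    (k : ℕ) : MemLp (fun ω => disagreementBound A ϖ ξ (fun j t => x j t ω) k) 2 P := by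
  induction k with
  | zero => exact (memLp_finsetSum Finset.univ fun j _ => (h 0 j).norm).const_mul ϖ
  | succ k ih =>
    exact (ih.const_mul ξ).add ((memLp_finsetSum Finset.univ fun j _ =>
      ((h (k + 1) j).sub (memLp_aggregate (A := A) (h k) j)).norm).const_mul ϖ)

theorem integrable_wdistSq [∀ l, CompleteSpace (H l)]
    [IsFiniteMeasure P] {C : Set (PiLp 2 H)} (hp : ∀ l, 0 < p l) (hne : C.Nonempty)
    (hcl : IsClosed C) (hcv : Convex ℝ C) {y : Ω → PiLp 2 H} (hy : MemLp y 2 P) :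
    Integrable (fun ω => wdistSq p C (y ω)) P := by
  obtain ⟨z, hz⟩ := hne
  refine (integrable_wnormSq hp (hy.sub (memLp_const z))).mono'
    ((continuous_wdistSq hp ⟨z, hz⟩ hcl hcv).comp_aestronglyMeasurable hy.1)
    (Eventually.of_forall fun ω => ?_)
  rw [Real.norm_of_nonneg (wdistSq_nonneg hp _)]
  exact wdistSq_le hp ⟨z, hz⟩ hcl hcv _ hz

theorem memLp_sub_weightedProj [∀ l, CompleteSpace (H l)] [IsFiniteMeasure P]
    (hF : ∀ i, LipschitzWith 1 (F i))
    (hne : (commonFix F).Nonempty) {k : ℕ} (hL : ∀ j, MemLp (x j k) 2 P) (i : Fin N) :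
    MemLp (fun ω => x i k ω - weightedProj F w x k ω) 2 P :=
  (hL i).sub (memLp_finsetSum Finset.univ fun j _ => ((lipschitzWith_metricProj hne
    (isClosed_commonFix hF) (convex_commonFix hF)).memLp_two_comp (hL j)).const_smul (w k j))

end Integrability

/-! ### One step of the iteration: independence, integrability and expected descent. -/

namespace IsDIBKM

variable {N m : ℕ} {H : Fin m → Type*} [∀ l, NormedAddCommGroup (H l)]
  [∀ l, InnerProductSpace ℝ (H l)] [∀ l, MeasurableSpace (H l)]
  {Ω : Type*} [MeasurableSpace Ω] {P : Measure Ω}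
  {F : Fin N → PiLp 2 H → PiLp 2 H} {A : ℕ → Matrix (Fin N) (Fin N) ℝ}
  {α : Fin N → ℕ → ℝ} {p : Fin m → ℝ} {b : Fin N → ℕ → Ω → Fin m → Bool}
  {ε x : Fin N → ℕ → Ω → PiLp 2 H} {αlow : ℝ}

theorem history_le (hx : IsDIBKM P F A α p b ε x) (k : ℕ) :
    history x k ≤ (inferInstance : MeasurableSpace Ω) :=
  iSup_le fun j => iSup_le fun t => iSup_le fun _ => (hx.measurable_x j t).comap_le

theorem indepFun_state (hx : IsDIBKM P F A α p b ε x) (i : Fin N) (k : ℕ) :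
    IndepFun (b i k) (fun ω => fun j => x j k ω) P := by
  rw [IndepFun_iff_Indep]
  refine indep_of_indep_of_le_right (hx.indep_history i k) ?_
  rw [← measurable_iff_comap_le]
  refine @measurable_pi_iff _ _ _ (history x k) _ _ |>.2 fun j => ?_
  rw [measurable_iff_comap_le]
  exact le_iSup_of_le j (le_iSup_of_le k (le_iSup_of_le le_rfl le_rfl))

theorem activation_prob (hx : IsDIBKM P F A α p b ε x) (i : Fin N) (k : ℕ) (l : Fin m) :
    P.real {ω | b i k ω l = true} = p l := by
  rw [← hx.prob i l, measureReal_def, measureReal_def]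
  congr 1
  exact (hx.identDistrib i k).measure_mem_eq (s := {c | c l = true})
    (measurable_pi_apply l (measurableSet_singleton true) :
      MeasurableSet ((fun c : Fin m → Bool => c l) ⁻¹' {true}))

theorem prob_le_one [IsProbabilityMeasure P] (hx : IsDIBKM P F A α p b ε x) (hN : 0 < N)
    (l : Fin m) : p l ≤ 1 := by
  rw [← hx.prob ⟨0, hN⟩ l]
  exact measureReal_le_one

theorem step_eq (hx : IsDIBKM P F A α p b ε x) (i : Fin N) (k : ℕ) :
    ∀ᵐ ω ∂P, x i (k + 1) ω = aggregate A x i k ω +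
      mask (b i k ω) (α i k • (F i (aggregate A x i k ω) - aggregate A x i k ω)) +
      α i k • mask (b i k ω) (ε i k ω) := by
  filter_upwards [hx.step i k] with ω h
  ext l
  rw [h l]
  simp only [PiLp.add_apply, PiLp.smul_apply, PiLp.sub_apply, mask_apply]
  split_ifs
  · module
  · simp

theorem norm_step_sub_le (hx : IsDIBKM P F A α p b ε x)
    (hα : ∀ i k, 0 ≤ α i k ∧ α i k ≤ 1) (i : Fin N) (k : ℕ) :
    ∀ᵐ ω ∂P, ‖x i (k + 1) ω - aggregate A x i k ω‖ ≤
      ‖F i (aggregate A x i k ω) - aggregate A x i k ω‖ + ‖mask (b i k ω) (ε i k ω)‖ := by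
  filter_upwards [hx.step_eq i k] with ω h
  rw [h, add_assoc, add_sub_cancel_left]
  refine (norm_add_le _ _).trans (add_le_add ((norm_mask_le _ _).trans ?_) ?_)
  · rw [norm_smul, Real.norm_of_nonneg (hα i k).1]
    exact mul_le_of_le_one_left (norm_nonneg _) (hα i k).2
  · rw [norm_smul, Real.norm_of_nonneg (hα i k).1]
    exact mul_le_of_le_one_left (norm_nonneg _) (hα i k).2

variable [∀ l, SecondCountableTopology (H l)] [∀ l, BorelSpace (H l)]

theorem measurable_aggregate (hx : IsDIBKM P F A α p b ε x) (i : Fin N) (k : ℕ) :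
    Measurable (aggregate A x i k) :=
  Finset.measurable_fun_sum _ fun j _ => (hx.measurable_x j k).fun_const_smul _

theorem memLp_state [IsFiniteMeasure P] (hx : IsDIBKM P F A α p b ε x)
    (hF : ∀ i, LipschitzWith 1 (F i)) (hα : ∀ i k, 0 ≤ α i k ∧ α i k ≤ 1)
    (hx0 : ∀ i, MemLp (x i 0) 2 P) (hε : ∀ i k, MemLp (ε i k) 2 P) (k : ℕ) (i : Fin N) :
    MemLp (x i k) 2 P := by
  induction k generalizing i with
  | zero => exact hx0 i
  | succ k ih =>
    have hG := memLp_aggregate (A := A) ih i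
    refine ((hG.norm.add (memLp_residual (A := A) hF ih i).norm).add (hε i k).norm).of_le
      (hx.measurable_x i (k + 1)).aestronglyMeasurable ?_
    filter_upwards [hx.norm_step_sub_le hα i k] with ω h
    have h1 := norm_le_norm_add_norm_sub' (x i (k + 1) ω) (aggregate A x i k ω)
    have h2 := norm_mask_le (b i k ω) (ε i k ω)
    simp only [Pi.add_apply]
    refine le_trans ?_ (le_abs_self _)
    linarith

section Descent

variable [∀ l, CompleteSpace (H l)] [IsProbabilityMeasure P]

/-- The error-free part of a step decreases the expected squared distance to the common fixed
points by a multiple of the fixed-point residual. -/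
theorem integral_wdistSq_exactStep_le (hx : IsDIBKM P F A α p b ε x)
    (hF : ∀ i, LipschitzWith 1 (F i)) (hne : (commonFix F).Nonempty)
    (hα : ∀ i k, 0 ≤ α i k ∧ α i k ≤ 1) {c : ℝ} (i : Fin N) (k : ℕ)
    (hc : c ≤ α i k * (1 - α i k)) (hL : ∀ j, MemLp (x j k) 2 P) :
    ∫ ω, wdistSq p (commonFix F) (aggregate A x i k ω +
        mask (b i k ω) (α i k • (F i (aggregate A x i k ω) - aggregate A x i k ω))) ∂P ≤
      ∫ ω, wdistSq p (commonFix F) (aggregate A x i k ω) ∂P -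
        c * ∫ ω, ‖F i (aggregate A x i k ω) - aggregate A x i k ω‖ ^ 2 ∂P := by
  have hcl := isClosed_commonFix hF
  have hcv := convex_commonFix hF
  have hp := hx.prob_pos
  have hG := memLp_aggregate (A := A) hL i
  have hR := memLp_residual (A := A) hF hL i
  let G : Ω → PiLp 2 H := aggregate A x i k
  let v : Ω → PiLp 2 H := fun ω => α i k • (F i (G ω) - G ω)
  let u : Ω → PiLp 2 H := fun ω => G ω - wproj p (commonFix F) (G ω)
  have hGm : Measurable G := hx.measurable_aggregate i k
  let gv : PiLp 2 H → PiLp 2 H := fun y => α i k • (F i y - y)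
  let gu : PiLp 2 H → PiLp 2 H := fun y => y - wproj p (commonFix F) y
  have hgv : Measurable gv :=
    (((hF i).continuous.sub continuous_id).const_smul (α i k)).measurable
  have hgu : Measurable gu := (continuous_id.sub (continuous_wproj hp hne hcl hcv)).measurable
  have hv2 : MemLp v 2 P := hR.const_smul (α i k)
  have hu2 : MemLp u 2 P := by
    have hi := integrable_wdistSq hp hne hcl hcv hG
    have hum : AEStronglyMeasurable u P := (hgu.comp hGm).aestronglyMeasurable
    refine (memLp_two_iff_integrable_sq_norm hum).2 (hi.mono' (hum.norm.pow 2)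
      (Eventually.of_forall fun ω => ?_))
    rw [Real.norm_of_nonneg (sq_nonneg _)]
    exact norm_sq_le_wnormSq hp (hx.prob_le_one i.pos) _
  -- The aggregate, its weighted projection and the increment are all functions of the states at
  -- time `k`, hence independent of the activation.
  have hind : IndepFun (b i k) (fun ω => (u ω, v ω)) P := by
    have hagg : Measurable fun z : Fin N → PiLp 2 H => ∑ j, A k i j • z j :=
      Finset.measurable_fun_sum _ fun j _ => (measurable_pi_apply j).fun_const_smul _
    exact (hx.indepFun_state i k).comp measurable_id
      ((hgu.comp hagg).prodMk (hgv.comp hagg))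
  have key := integral_wnormSq_add_mask (hx.measurable_b i k) (hgu.comp hGm) (hgv.comp hGm) hind
    (hx.activation_prob i k) hp hu2 hv2
  have hmask : MemLp (fun ω => mask (b i k ω) (v ω)) 2 P :=
    memLp_mask (hx.measurable_b i k) (hgv.comp hGm) hv2
  calc _ ≤ ∫ ω, wnormSq p (u ω + mask (b i k ω) (v ω)) ∂P := by
        -- The new distance is bounded using the old projection, which does not depend on the
        -- activation.
        refine integral_mono (integrable_wdistSq hp hne hcl hcv (hG.add hmask))
          (integrable_wnormSq hp (hu2.add hmask)) fun ω => ?_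
        refine (wdistSq_le hp hne hcl hcv _ (wproj_mem hp hne hcl hcv (G ω))).trans_eq ?_
        rw [add_sub_right_comm]
    _ = ∫ ω, wnormSq p (u ω) ∂P + ∫ ω, (‖u ω + v ω‖ ^ 2 - ‖u ω‖ ^ 2) ∂P := key
    _ ≤ ∫ ω, wnormSq p (u ω) ∂P + ∫ ω, -(c * ‖F i (G ω) - G ω‖ ^ 2) ∂P := by
        refine add_le_add_right (integral_mono
          ((hu2.add hv2).integrable_norm_sq.sub hu2.integrable_norm_sq)
          (hR.integrable_norm_sq.const_mul c).neg fun ω => ?_) _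
        -- After averaging, the norm is the plain one. The descent holds for any fixed point, so it
        -- applies to the weighted projection.
        have h1 := norm_relaxed_sub_sq_le (hF i) (wproj_mem hp hne hcl hcv (G ω) i)
          (hα i k).1 (G ω)
        have h2 : c * ‖F i (G ω) - G ω‖ ^ 2 ≤
            α i k * (1 - α i k) * ‖F i (G ω) - G ω‖ ^ 2 :=
          mul_le_mul_of_nonneg_right hc (sq_nonneg _)
        have h3 : u ω + v ω = G ω + α i k • (F i (G ω) - G ω) - wproj p (commonFix F) (G ω) := by
          simp only [u, v]; abel
        simp only [Pi.sub_apply, Pi.add_apply, Pi.neg_apply, h3]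
        simp only [u]
        change _ ≤ -(c * ‖F i (G ω) - G ω‖ ^ 2)
        linarith
    _ = _ := by
        rw [integral_neg, integral_const_mul, ← sub_eq_add_neg]
        rfl

/-- The errors may be correlated with the states and activations, so they are split off by Young's
inequality with a parameter `η`, to be fixed in the Lyapunov argument. -/
theorem integral_wdistSq_step_le (hx : IsDIBKM P F A α p b ε x)
    (hF : ∀ i, LipschitzWith 1 (F i)) (hne : (commonFix F).Nonempty)
    (hα : ∀ i k, 0 ≤ α i k ∧ α i k ≤ 1) {c : ℝ} (i : Fin N) (k : ℕ)
    (hc : c ≤ α i k * (1 - α i k)) (hL : ∀ k j, MemLp (x j k) 2 P)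
    (hε : ∀ i k, MemLp (ε i k) 2 P) {η : ℝ} (hη : 0 < η) :
    ∫ ω, wdistSq p (commonFix F) (x i (k + 1) ω) ∂P ≤
      (1 + η) * (∫ ω, wdistSq p (commonFix F) (aggregate A x i k ω) ∂P -
        c * ∫ ω, ‖F i (aggregate A x i k ω) - aggregate A x i k ω‖ ^ 2 ∂P) +
      (1 + 1 / η) * ((∑ l, 1 / p l) * ∫ ω, ‖mask (b i k ω) (ε i k ω)‖ ^ 2 ∂P) := by
  have hcl := isClosed_commonFix hF
  have hcv := convex_commonFix hF
  have hp := hx.prob_pos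
  have hG := memLp_aggregate (A := A) (hL k) i
  have hR := memLp_residual (A := A) hF (hL k) i
  have hv : MemLp (fun ω => mask (b i k ω)
      (α i k • (F i (aggregate A x i k ω) - aggregate A x i k ω))) 2 P := by
    refine memLp_mask (hx.measurable_b i k) ?_ (hR.const_smul (α i k))
    exact ((((hF i).continuous.measurable.comp (hx.measurable_aggregate i k)).sub
      (hx.measurable_aggregate i k)).fun_const_smul (α i k))
  have hM := memLp_mask (hx.measurable_b i k) (hx.measurable_ε i k) (hε i k)
  have hD : Integrable (fun ω => wdistSq p (commonFix F) (aggregate A x i k ω + mask (b i k ω)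
      (α i k • (F i (aggregate A x i k ω) - aggregate A x i k ω)))) P :=
    integrable_wdistSq hp hne hcl hcv (hG.add hv)
  refine le_trans ?_ (add_le_add_left (mul_le_mul_of_nonneg_left
    (hx.integral_wdistSq_exactStep_le hF hne hα i k hc (hL k)) (by linarith)) _)
  rw [← integral_const_mul, ← integral_const_mul, ← integral_const_mul,
    ← integral_add (hD.const_mul _) ((hM.integrable_norm_sq.const_mul _).const_mul _)]
  refine integral_mono_ae (integrable_wdistSq hp hne hcl hcv (hL (k + 1) i))
    ((hD.const_mul _).add ((hM.integrable_norm_sq.const_mul _).const_mul _)) ?_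
  filter_upwards [hx.step_eq i k] with ω h
  rw [h]
  refine (wdistSq_add_le hp hne hcl hcv hη _ _).trans (add_le_add_right
    (mul_le_mul_of_nonneg_left ((wnormSq_le hp _).trans (mul_le_mul_of_nonneg_left ?_
      (Finset.sum_nonneg fun l _ => (one_div_pos.2 (hp l)).le))) (by positivity)) _)
  refine pow_le_pow_left₀ (norm_nonneg _) ?_ 2
  rw [norm_smul, Real.norm_of_nonneg (hα i k).1]
  exact mul_le_of_le_one_left (norm_nonneg _) (hα i k).2

end Descent

end IsDIBKM

/-! ### Recursions for errors, disagreement and mean distance. -/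

namespace IsDIBKM

variable {N m : ℕ} {H : Fin m → Type*} [∀ l, NormedAddCommGroup (H l)]
  [∀ l, InnerProductSpace ℝ (H l)] [∀ l, MeasurableSpace (H l)]
  {Ω : Type*} [MeasurableSpace Ω] {P : Measure Ω}
  {F : Fin N → PiLp 2 H → PiLp 2 H} {A : ℕ → Matrix (Fin N) (Fin N) ℝ}
  {α : Fin N → ℕ → ℝ} {p : Fin m → ℝ} {b : Fin N → ℕ → Ω → Fin m → Bool}
  {ε x : Fin N → ℕ → Ω → PiLp 2 H} {w : ℕ → Fin N → ℝ} {ϖ ξ wmin ν : ℝ}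
  [∀ l, SecondCountableTopology (H l)] [∀ l, BorelSpace (H l)] [IsProbabilityMeasure P]

/-- The second moments of the effective errors vanish. -/
theorem tendsto_integral_mask_error (hx : IsDIBKM P F A α p b ε x)
    (hε : ∀ i k, MemLp (ε i k) 2 P)
    (hεsum : ∀ i, ∀ᵐ ω ∂P,
      Summable fun k => √((P[fun ω' => ‖ε i k ω'‖ ^ 2 | history x k]) ω))
    (hεdom : ∃ g : Ω → ℝ, Integrable g P ∧ ∀ i k, ∀ᵐ ω ∂P,
      (P[fun ω' => ‖mask (b i k ω') (ε i k ω')‖ ^ 2 | history x k]) ω ≤ g ω) (i : Fin N) :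
    Tendsto (fun k => ∫ ω, ‖mask (b i k ω) (ε i k ω)‖ ^ 2 ∂P) atTop (𝓝 0) := by
  obtain ⟨g, hg, hdom⟩ := hεdom
  have hM : ∀ k, Integrable (fun ω => ‖mask (b i k ω) (ε i k ω)‖ ^ 2) P := fun k =>
    (memLp_mask (hx.measurable_b i k) (hx.measurable_ε i k) (hε i k)).integrable_norm_sq
  have hE : ∀ k, Integrable (fun ω => ‖ε i k ω‖ ^ 2) P := fun k => (hε i k).integrable_norm_sq
  have hnn : ∀ᵐ ω ∂P, ∀ k,
      0 ≤ (P[fun ω' => ‖mask (b i k ω') (ε i k ω')‖ ^ 2 | history x k]) ω := by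
    refine ae_all_iff.2 fun k => ?_
    exact condExp_nonneg (Eventually.of_forall fun ω => sq_nonneg _)
  have hle : ∀ᵐ ω ∂P, ∀ k,
      (P[fun ω' => ‖mask (b i k ω') (ε i k ω')‖ ^ 2 | history x k]) ω ≤
        (P[fun ω' => ‖ε i k ω'‖ ^ 2 | history x k]) ω := by
    refine ae_all_iff.2 fun k => ?_
    exact condExp_mono (hM k) (hE k) (Eventually.of_forall fun ω =>
      pow_le_pow_left₀ (norm_nonneg _) (norm_mask_le _ _) 2)
  -- Summability of the square roots makes the conditional moments of the full errors vanish almost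
  -- surely, and masking only decreases them.
  have hlim : ∀ᵐ ω ∂P, Tendsto
      (fun k => (P[fun ω' => ‖mask (b i k ω') (ε i k ω')‖ ^ 2 | history x k]) ω) atTop (𝓝 0) := by
    filter_upwards [hnn, hle, hεsum i] with ω h0 h1 h2
    have h3 := (h2.tendsto_atTop_zero).pow 2
    rw [zero_pow two_ne_zero] at h3
    refine squeeze_zero h0 h1 (h3.congr fun k => ?_)
    exact Real.sq_sqrt ((h0 k).trans (h1 k))
  have := tendsto_integral_of_dominated_convergence (F := fun k =>
      P[fun ω' => ‖mask (b i k ω') (ε i k ω')‖ ^ 2 | history x k]) g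
    (fun k => integrable_condExp.aestronglyMeasurable) hg (fun k => ?_) hlim
  -- Conditional expectations preserve the integral, so convergence passes to the unconditional
  -- second moments.
  · simpa only [integral_condExp (hx.history_le _), integral_zero] using this
  · filter_upwards [hnn, hdom i k] with ω h0 h1
    rwa [Real.norm_of_nonneg (h0 k)]

/-- One step of the mean-square disagreement bound. -/
theorem integral_disagreementBound_sq_succ_le (hx : IsDIBKM P F A α p b ε x)
    (hF : ∀ i, LipschitzWith 1 (F i)) (hα : ∀ i k, 0 ≤ α i k ∧ α i k ≤ 1)
    (hL : ∀ k j, MemLp (x j k) 2 P) (hε : ∀ i k, MemLp (ε i k) 2 P)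
    (hξ0 : 0 ≤ ξ) (hξ1 : ξ < 1) (k : ℕ) :
    ∫ ω, disagreementBound A ϖ ξ (fun j t => x j t ω) (k + 1) ^ 2 ∂P ≤
      ξ * ∫ ω, disagreementBound A ϖ ξ (fun j t => x j t ω) k ^ 2 ∂P +
      2 * N * ϖ ^ 2 / (1 - ξ) *
        (∑ i, ∫ ω, ‖F i (aggregate A x i k ω) - aggregate A x i k ω‖ ^ 2 ∂P +
          ∑ i, ∫ ω, ‖mask (b i k ω) (ε i k ω)‖ ^ 2 ∂P) := by
  have hφ : ∀ k, Integrable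
      (fun ω => disagreementBound A ϖ ξ (fun j t => x j t ω) k ^ 2) P := fun k =>
    (memLp_disagreementBound hL ϖ ξ k).integrable_sq
  have hR := fun i => (memLp_residual (A := A) hF (hL k) i).integrable_norm_sq
  have hM := fun i =>
    (memLp_mask (hx.measurable_b i k) (hx.measurable_ε i k) (hε i k)).integrable_norm_sq
  have h1ξ : 0 < 1 - ξ := by linarith
  have hRs := integrable_finsetSum Finset.univ fun i _ => hR i
  have hMs := integrable_finsetSum Finset.univ fun i _ => hM i
  have hRM : Integrable (fun ω =>
      ∑ i, ‖F i (aggregate A x i k ω) - aggregate A x i k ω‖ ^ 2 +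
        ∑ i, ‖mask (b i k ω) (ε i k ω)‖ ^ 2) P := hRs.add hMs
  rw [← integral_finsetSum _ fun i _ => hR i, ← integral_finsetSum _ fun i _ => hM i,
    ← integral_add hRs hMs, ← integral_const_mul, ← integral_const_mul,
    ← integral_add ((hφ k).const_mul _) (hRM.const_mul _)]
  refine integral_mono_ae (hφ (k + 1)) (((hφ k).const_mul _).add (hRM.const_mul _)) ?_
  filter_upwards [ae_all_iff.2 fun i => hx.norm_step_sub_le hα i k] with ω h
  rw [disagreementBound]
  refine (contraction_add_sq_le hξ0 hξ1 _ _).trans (add_le_add_right ?_ _)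
  have h1 : (∑ j, ‖x j (k + 1) ω - ∑ l, A k j l • x l k ω‖) ^ 2 ≤
      N * (2 * (∑ i, ‖F i (aggregate A x i k ω) - aggregate A x i k ω‖ ^ 2 +
          ∑ i, ‖mask (b i k ω) (ε i k ω)‖ ^ 2)) := by
    refine (sum_sq_le_card_mul _).trans (mul_le_mul_of_nonneg_left ?_ (Nat.cast_nonneg _))
    rw [← Finset.sum_add_distrib, Finset.mul_sum]
    exact Finset.sum_le_sum fun i _ =>
      (pow_le_pow_left₀ (norm_nonneg _) (h i) 2).trans add_sq_le
  rw [mul_pow, div_eq_mul_inv, div_eq_mul_inv]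
  calc _ ≤ ϖ ^ 2 * (N * (2 * (∑ i, ‖F i (aggregate A x i k ω) - aggregate A x i k ω‖ ^ 2 +
          ∑ i, ‖mask (b i k ω) (ε i k ω)‖ ^ 2))) * (1 - ξ)⁻¹ := by gcongr
    _ = _ := by ring

variable [∀ l, CompleteSpace (H l)]

/-- The weighted expected squared distance of the states to the common fixed points. -/
noncomputable def meanDistSq (P : Measure Ω) (F : Fin N → PiLp 2 H → PiLp 2 H) (p : Fin m → ℝ)
    (w : ℕ → Fin N → ℝ) (x : Fin N → ℕ → Ω → PiLp 2 H) (k : ℕ) : ℝ :=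
  ∑ i, w k i * ∫ ω, wdistSq p (commonFix F) (x i k ω) ∂P

/-- Mixing is free: averaging the distances with row `i` of `A k` and then with `w (k + 1)` is
averaging with `w k`. The lower bound `wmin` keeps the descent of every agent in the sum. -/
theorem meanDistSq_succ_le (hx : IsDIBKM P F A α p b ε x)
    (hF : ∀ i, LipschitzWith 1 (F i)) (hne : (commonFix F).Nonempty)
    (hA : ConnectivityAndWeights A) (hw : IsMixing A w ϖ ξ wmin)
    (hα : ∀ i k, 0 ≤ α i k ∧ α i k ≤ 1) {c : ℝ} (hc0 : 0 ≤ c)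
    (hc : ∀ i k, c ≤ α i k * (1 - α i k)) (hL : ∀ k j, MemLp (x j k) 2 P)
    (hε : ∀ i k, MemLp (ε i k) 2 P) {η : ℝ} (hη : 0 < η) (k : ℕ) :
    meanDistSq P F p w x (k + 1) ≤
      (1 + η) * (meanDistSq P F p w x k - wmin * c *
        ∑ i, ∫ ω, ‖F i (aggregate A x i k ω) - aggregate A x i k ω‖ ^ 2 ∂P) +
      (1 + 1 / η) * ((∑ l, 1 / p l) * ∑ i, ∫ ω, ‖mask (b i k ω) (ε i k ω)‖ ^ 2 ∂P) := by
  have hcl := isClosed_commonFix hF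
  have hcv := convex_commonFix hF
  have hp := hx.prob_pos
  have hwnn : ∀ k j, 0 ≤ w k j := fun k j => hw.wmin_pos.le.trans (hw.lower k j)
  have hw1 : ∀ k j, w k j ≤ 1 := fun k j => by
    rw [← hw.sum_eq_one k]
    exact Finset.single_le_sum (fun i _ => hwnn k i) (Finset.mem_univ j)
  have hCp : 0 ≤ ∑ l, 1 / p l := Finset.sum_nonneg fun l _ => (one_div_pos.2 (hp l)).le
  set R := fun i => ∫ ω, ‖F i (aggregate A x i k ω) - aggregate A x i k ω‖ ^ 2 ∂P
  set e := fun i => ∫ ω, ‖mask (b i k ω) (ε i k ω)‖ ^ 2 ∂P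
  set d := fun j => ∫ ω, wdistSq p (commonFix F) (x j k ω) ∂P
  have hR : ∀ i, 0 ≤ R i := fun i => integral_nonneg fun _ => sq_nonneg _
  have he : ∀ i, 0 ≤ e i := fun i => integral_nonneg fun _ => sq_nonneg _
  have hd : ∀ j, Integrable (fun ω => wdistSq p (commonFix F) (x j k ω)) P := fun j =>
    integrable_wdistSq hp hne hcl hcv (hL k j)
  have hagg : ∀ i, ∫ ω, wdistSq p (commonFix F) (aggregate A x i k ω) ∂P ≤ ∑ j, A k i j * d j := by
    intro i
    simp only [d]
    simp only [← integral_const_mul]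
    rw [← integral_finsetSum _ fun j _ => (hd j).const_mul _]
    exact integral_mono (integrable_wdistSq hp hne hcl hcv (memLp_aggregate (hL k) i))
      (integrable_finsetSum _ fun j _ => (hd j).const_mul _) fun ω =>
        wdistSq_sum_smul_le hp hne hcl hcv (hA.nonneg k i) (hA.row_sum k i) _
  have hmix : ∑ i, w (k + 1) i * ∑ j, A k i j * d j = meanDistSq P F p w x k := by
    rw [meanDistSq, hw.invariant k]
    simp only [Matrix.vecMul, dotProduct, Finset.mul_sum, Finset.sum_mul]
    rw [Finset.sum_comm]
    simp only [mul_assoc, d]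
  calc meanDistSq P F p w x (k + 1)
      ≤ ∑ i, w (k + 1) i * ((1 + η) * (∑ j, A k i j * d j - c * R i) +
          (1 + 1 / η) * ((∑ l, 1 / p l) * e i)) := by
        refine Finset.sum_le_sum fun i _ => mul_le_mul_of_nonneg_left ?_ (hwnn _ i)
        refine (hx.integral_wdistSq_step_le hF hne hα i k (hc i k) hL hε hη).trans ?_
        exact add_le_add_left (mul_le_mul_of_nonneg_left (sub_le_sub_right (hagg i) _)
          (by linarith)) _
    _ = (1 + η) * (meanDistSq P F p w x k - ∑ i, w (k + 1) i * (c * R i)) +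
          (1 + 1 / η) * ((∑ l, 1 / p l) * ∑ i, w (k + 1) i * e i) := by
        rw [← hmix, ← Finset.sum_sub_distrib, Finset.mul_sum, Finset.mul_sum, Finset.mul_sum,
          ← Finset.sum_add_distrib]
        exact Finset.sum_congr rfl fun i _ => by ring
    _ ≤ _ := by
        have h1 : wmin * c * ∑ i, R i ≤ ∑ i, w (k + 1) i * (c * R i) := by
          rw [mul_assoc, Finset.mul_sum, Finset.mul_sum]
          exact Finset.sum_le_sum fun i _ =>
            mul_le_mul_of_nonneg_right (hw.lower _ i) (mul_nonneg hc0 (hR i))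
        have h2 : ∑ i, w (k + 1) i * e i ≤ ∑ i, e i :=
          Finset.sum_le_sum fun i _ => mul_le_of_le_one_left (he i) (hw1 _ i)
        gcongr

end IsDIBKM

/-! ### The convergence theorem. -/

theorem theorem5 {N m : ℕ} (hN : 0 < N) (hm : 0 < m)
    {H : Fin m → Type*} [∀ l, NormedAddCommGroup (H l)] [∀ l, InnerProductSpace ℝ (H l)]
    [∀ l, CompleteSpace (H l)] [∀ l, SecondCountableTopology (H l)]
    [∀ l, MeasurableSpace (H l)] [∀ l, BorelSpace (H l)]
    {Ω : Type*} [MeasurableSpace Ω] (P : Measure Ω) [IsProbabilityMeasure P]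
    (F : Fin N → PiLp 2 H → PiLp 2 H) (A : ℕ → Matrix (Fin N) (Fin N) ℝ)
    (αlow : ℝ) (α : Fin N → ℕ → ℝ) (p : Fin m → ℝ)
    (b : Fin N → ℕ → Ω → Fin m → Bool) (ε x : Fin N → ℕ → Ω → PiLp 2 H)
    -- the operators are nonexpansive and boundedly power regular
    (hF : ∀ i, LipschitzWith 1 (F i)) (hreg : BoundedlyPowerRegular F)
    -- the network, the relaxation parameters and the iteration
    (hA : ConnectivityAndWeights A)
    (hαlow : 0 < αlow ∧ αlow ≤ 1 / 2) (hα : ∀ i k, α i k ∈ Set.Icc αlow (1 - αlow))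
    (hx : IsDIBKM P F A α p b ε x) (hx0 : ∀ i, MemLp (x i 0) 2 P)
    -- summability and domination of the conditional second moments of the errors
    (hε : ∀ i k, MemLp (ε i k) 2 P)
    (hεsum : ∀ i, ∀ᵐ ω ∂P,
      Summable fun k => √((P[fun ω' => ‖ε i k ω'‖ ^ 2 | history x k]) ω))
    (hεdom : ∃ g : Ω → ℝ, Integrable g P ∧ ∀ i k, ∀ᵐ ω ∂P,
      (P[fun ω' => ‖mask (b i k ω') (ε i k ω')‖ ^ 2 | history x k]) ω ≤ g ω) :
    -- the weights `π_{i,k}` and the constants `ϖ`, `ξ`, `π_min` exist, and for every choice of them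
    (∃ (w : ℕ → Fin N → ℝ) (ϖ ξ wmin : ℝ), IsMixing A w ϖ ξ wmin) ∧
    ∀ (w : ℕ → Fin N → ℝ) (ϖ ξ wmin : ℝ), IsMixing A w ϖ ξ wmin →
    -- `ν` is a regularity constant on the balls centred at `0` that the iterates span
    ∀ ν : ℝ, 0 < ν →
    (∀ᵐ ω ∂P, ∀ y : PiLp 2 H, (∃ i k, ‖y‖ ≤ ‖x i k ω‖) →
      Metric.infDist y (commonFix F) ≤ ν * ∑ i, ‖F i y - y‖) →
    StepSizeBound α αlow p ϖ ξ wmin ν →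
    ∀ i,
      (∀ k, Integrable (fun ω => wnormSq p (x i k ω - weightedProj F w x k ω)) P) ∧
      Tendsto (fun k => ∫ ω, wnormSq p (x i k ω - weightedProj F w x k ω) ∂P) atTop (𝓝 0) ∧
      ((∀ j k, ∀ᵐ ω ∂P, ε j k ω = 0) →
        (fun k => ∫ ω, wnormSq p (x i k ω - weightedProj F w x k ω) ∂P) =O[atTop]
          fun k : ℕ => 1 / (k : ℝ) ^ Real.log (1 / ξ)) := by
  refine ⟨hA.exists_isMixing hN, fun w ϖ ξ wmin hw ν hν hνreg _ i => ?_⟩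
  have hne := hreg.1
  have hcl := isClosed_commonFix hF
  have hcv := convex_commonFix hF
  have hp := hx.prob_pos
  have hp1 := hx.prob_le_one hN
  have hα' : ∀ i k, 0 ≤ α i k ∧ α i k ≤ 1 := fun i k =>
    ⟨hαlow.1.le.trans (hα i k).1, (hα i k).2.trans (by linarith)⟩
  -- Both `α i k` and `1 - α i k` are at least `αlow`.
  have hc : ∀ i k, αlow ^ 2 ≤ α i k * (1 - α i k) := fun i k => by
    have h1 := (hα i k).1
    have h2 := (hα i k).2
    nlinarith
  have hL := hx.memLp_state hF hα' hx0 hε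
  have : Nonempty (Fin m) := ⟨⟨0, hm⟩⟩
  have hCp : 0 < ∑ l, 1 / p l :=
    Finset.sum_pos (fun l _ => one_div_pos.2 (hp l)) Finset.univ_nonempty
  have hN' : (0 : ℝ) < N := by exact_mod_cast hN
  have hϖ := hw.ϖ_pos
  have h1ξ : 0 < 1 - ξ := by linarith [hw.ξ_lt_one]
  have hwnn : ∀ k j, 0 ≤ w k j := fun k j => hw.wmin_pos.le.trans (hw.lower k j)
  have hαl := hαlow.1
  have hwm := hw.wmin_pos
  obtain ⟨η, β, ρ, K, hη, hβ, hρ0, hρ1, hK, hlyap⟩ := exists_lyapunov_weights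
    (c := wmin * αlow ^ 2) (C₀ := ∑ l, 1 / p l) (C₁ := 2 * N * ϖ ^ 2 / (1 - ξ))
    (C₂ := (∑ l, 1 / p l) * (32 * N ^ 2 * ν ^ 2)) (by positivity) hCp.le (by positivity)
    (by positivity) hw.ξ_pos hw.ξ_lt_one
  let D : ℕ → ℝ := IsDIBKM.meanDistSq P F p w x
  let Φ : ℕ → ℝ := fun k => ∫ ω, disagreementBound A ϖ ξ (fun j t => x j t ω) k ^ 2 ∂P
  let R : ℕ → ℝ := fun k =>
    ∑ i, ∫ ω, ‖F i (aggregate A x i k ω) - aggregate A x i k ω‖ ^ 2 ∂P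
  let e : ℕ → ℝ := fun k => ∑ i, ∫ ω, ‖mask (b i k ω) (ε i k ω)‖ ^ 2 ∂P
  have hd : ∀ k j, Integrable (fun ω => wdistSq p (commonFix F) (x j k ω)) P := fun k j =>
    integrable_wdistSq hp hne hcl hcv (hL k j)
  have hφ : ∀ k, Integrable
      (fun ω => disagreementBound A ϖ ξ (fun j t => x j t ω) k ^ 2) P := fun k =>
    (memLp_disagreementBound hL ϖ ξ k).integrable_sq
  have hD : ∀ k, 0 ≤ D k := fun k => Finset.sum_nonneg fun j _ =>
    mul_nonneg (hwnn k j) (integral_nonneg fun _ => wdistSq_nonneg hp _)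
  have hΦ : ∀ k, 0 ≤ Φ k := fun k => integral_nonneg fun _ => sq_nonneg _
  have hR : ∀ k, 0 ≤ R k := fun k =>
    Finset.sum_nonneg fun j _ => integral_nonneg fun _ => sq_nonneg _
  have hRi := fun k i => (memLp_residual (A := A) hF (hL k) i).integrable_norm_sq
  have hregD : ∀ k, D k ≤ (∑ l, 1 / p l) * (32 * N ^ 2 * ν ^ 2) * (R k + Φ k) := by
    intro k
    have hj : ∀ j, ∫ ω, wdistSq p (commonFix F) (x j k ω) ∂P ≤
        (∑ l, 1 / p l) * (32 * N ^ 2 * ν ^ 2) * (R k + Φ k) := by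
      intro j
      have hRs := integrable_finsetSum Finset.univ fun i _ => hRi k i
      simp only [R, Φ]
      rw [← integral_finsetSum _ fun i _ => hRi k i, ← integral_add hRs (hφ k),
        ← integral_const_mul]
      refine integral_mono_ae (hd k j) ((hRs.add (hφ k)).const_mul _) ?_
      filter_upwards [hνreg] with ω h
      exact wdistSq_state_le hF hne hp hA hw j k ω (h _ ⟨j, k, le_rfl⟩)
    calc D k ≤ ∑ j, w k j * ((∑ l, 1 / p l) * (32 * N ^ 2 * ν ^ 2) * (R k + Φ k)) :=
          Finset.sum_le_sum fun j _ => mul_le_mul_of_nonneg_left (hj j) (hwnn k j)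
      _ = _ := by rw [← Finset.sum_mul, hw.sum_eq_one, one_mul]
  let L : ℕ → ℝ := fun k => D k + β * Φ k
  have hL0 : ∀ k, 0 ≤ L k := fun k => add_nonneg (hD k) (mul_nonneg hβ.le (hΦ k))
  have hLstep : ∀ k, L (k + 1) ≤ ρ * L k + K * e k := fun k =>
    hlyap (D k) (Φ k) (R k) (e k) (D (k + 1)) (Φ (k + 1)) (hD k) (hΦ k) (hR k)
      (hx.meanDistSq_succ_le hF hne hA hw hα' (sq_nonneg αlow) hc hL hε hη k)
      (hx.integral_disagreementBound_sq_succ_le hF hα' hL hε hw.ξ_pos.le hw.ξ_lt_one k)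
      (hregD k)
  have he : Tendsto e atTop (𝓝 0) := by
    simpa using tendsto_finsetSum Finset.univ fun i _ =>
      hx.tendsto_integral_mask_error hε hεsum hεdom i
  have hint : ∀ k, Integrable (fun ω => wnormSq p (x i k ω - weightedProj F w x k ω)) P :=
    fun k => integrable_wnormSq hp (memLp_sub_weightedProj hF hne (hL k) i)
  have hnn : ∀ k, 0 ≤ ∫ ω, wnormSq p (x i k ω - weightedProj F w x k ω) ∂P := fun k =>
    integral_nonneg fun _ => wnormSq_nonneg hp _
  -- The factor `8 / β + 2` makes `B * L k` dominate `8 * Φ k + 2 * D k`, up to the common factor `∑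
  -- l, 1 / p l`.
  set B : ℝ := (∑ l, 1 / p l) * (8 / β + 2) with hB
  have hbound : ∀ k, ∫ ω, wnormSq p (x i k ω - weightedProj F w x k ω) ∂P ≤ B * L k := by
    intro k
    have hsum := integrable_finsetSum Finset.univ fun j _ => (hd k j).const_mul (w k j)
    calc _ ≤ ∫ ω, (∑ l, 1 / p l) *
          (8 * disagreementBound A ϖ ξ (fun j t => x j t ω) k ^ 2 +
            2 * ∑ j, w k j * wdistSq p (commonFix F) (x j k ω)) ∂P :=
          integral_mono (hint k)
            ((((hφ k).const_mul 8).add (hsum.const_mul 2)).const_mul _) fun ω =>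
              wnormSq_sub_weightedProj_le hF hne hp hp1 hw i k ω
      _ = (∑ l, 1 / p l) * (8 * Φ k + 2 * D k) := by
          rw [integral_const_mul, integral_add ((hφ k).const_mul 8) (hsum.const_mul 2),
            integral_const_mul, integral_const_mul,
            integral_finsetSum _ fun j _ => (hd k j).const_mul (w k j)]
          simp only [integral_const_mul, D, Φ, IsDIBKM.meanDistSq]
      _ ≤ _ := by
          rw [hB, mul_assoc]
          refine mul_le_mul_of_nonneg_left ?_ hCp.le
          have e1 : (8 / β + 2) * L k = 8 * Φ k + 2 * D k + (8 / β * D k + 2 * β * Φ k) := by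
            simp only [L]; field_simp; ring
          have h1 : 0 ≤ 8 / β * D k := mul_nonneg (by positivity) (hD k)
          have h2 : 0 ≤ 2 * β * Φ k := mul_nonneg (by positivity) (hΦ k)
          linarith
  refine ⟨hint, ?_, fun hε0 => ?_⟩
  · have hLlim := tendsto_zero_of_le_mul_add hρ0.le hρ1 hL0
      (by simpa using he.const_mul K) hLstep
    exact squeeze_zero hnn hbound (by simpa using hLlim.const_mul B)
  · have he0 : ∀ k, e k = 0 := fun k => Finset.sum_eq_zero fun j _ => by
      refine integral_eq_zero_of_ae ?_
      filter_upwards [hε0 j k] with ω h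
      have h1 := norm_mask_le (b j k ω) (ε j k ω)
      rw [h, norm_zero] at h1
      rw [h, le_antisymm h1 (norm_nonneg _)]
      simp
    -- With no errors the recursion is a pure contraction, so `L k ≤ ρ ^ k * L 0`.
    have hgeo := le_geometric_add_const (L := L) (δ := 0) (k₀ := 0) hρ0.le fun k _ => by
      simpa [he0] using hLstep k
    refine IsBigO.trans (IsBigO.of_bound (B * L 0) (Eventually.of_forall fun k => ?_))
      (isBigO_pow_one_div_rpow hρ0 hρ1 _)
    rw [Real.norm_of_nonneg (hnn k), Real.norm_of_nonneg (by positivity)]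
    have h1 := hgeo k
    simp only [zero_add, sub_zero] at h1
    calc _ ≤ B * L k := hbound k
      _ ≤ B * (ρ ^ k * L 0) := mul_le_mul_of_nonneg_left h1 (by positivity)
      _ = _ := by ring
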